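/- Let $A$ be a unital simple separable $C^*$-algebra whose set $T(A)$ of tracial states is non-empty, let $\omega$ be a free ultrafilter on $\mathbb{N}$, and let $\alpha$ be an automorphism of $A$. Write $A_\omega = \ell^\infty(\mathbb{N},A)/\{(a_n) : \lim_{n\to\omega}\|a_n\| = 0\}$, let $F(A) = A_\omega\cap A'$ be the relative commutant of the constant sequences, let $\alpha_\omega$ be the automorphism $\alpha_\omega((a_n)_n) = (\alpha(a_n))_n$ of $A_\omega$, and put $$\|(a_n)_n\|_{2,\omega} = \lim_{n\to\omega}\ \sup_{\tau\in T(A)}\tau(a_n^*a_n)^{1/2},\qquad J_A = \{x\in A_\omega : \|x\|_{2,\omega} = 0\}.$$ Assume that $A$ has property (SI): for all positive contractions $e,f\in F(A)$ with $e\in J_A$ and $\sup_{n}\|1-f^n\|_{2,\omega}<1$ there exists $s\in F(A)$ with $fs=s$ and $s^*s=e$. Assume also that $\alpha$ has the approximate Rokhlin property: for every $n\geq 1$ there are positive contractions $f_1,\dots,f_n\in F(A)$ with $\alpha_\omega(f_k)=f_{k+1}$ for $1\le k\le n$ (indices mod $n$), $f_kf_l=0$ for $k\neq l$, $1-\sum_{k=1}^n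 f_k\in J_A\cap F(A)$, and $\sup_{j}\|1-f_1^j\|_{2,\omega}<1$. Then for every $m\geq 1$ there exist positive contractions $a_1,\dots,a_m,\ b_1,\dots,b_m,\ c_1,\dots,c_{m+1}$ in $F(A)$ such that (i) $\alpha_\omega(a_k)=a_{k+1}$ and $\alpha_\omega(b_k)=b_{k+1}$ for $1\le k\le m$ (indices mod $m$); (ii) $\alpha_\omega(c_k)=c_{k+1}$ for $1\le k\le m+1$ (indices mod $m+1$); (iii) $a_ia_j=0$ and $b_ib_j=0$ for $1\le i\ne j\le m$; (iv) $c_ic_j=0$ for $1\le i\neq j\le m+1$; (v) $b_ic_j=0$ for $1\le i\le m$, $1\le j\le m+1$; (vi) $\sum_{k=1}^m a_k+\sum_{k=1}^m b_k+\sum_{k=1}^{m+1}c_k=1$. In particular $\dim_{\mathrm{Rok}}(\alpha)\le 1$. Here $\dim_{\mathrm{Rok}}(\alpha)$ is the least $d\in\{0,1,2,\dots\}$ (and $\infty$ if there is none) such that for every finite $F\subseteq A$, every $p\ge 1$ and every $\varepsilon>0$ there are positive contractions $f^{(l)}_{r,j}\in A$ $(0\le l\le d,\ r\in\{0,1\},\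 0\le j\le p-1+r)$ with: $\|f^{(l)}_{q,i}f^{(l)}_{r,j}\|<\varepsilon$ for all $l$ and $(q,i)\ne(r,j)$; $\|\sum_{l,r,j}f^{(l)}_{r,j}-1\|<\varepsilon$; $\|\alpha(f^{(l)}_{r,j})-f^{(l)}_{r,j+1}\|<\varepsilon$ for all $l$, $r$ and $0\le j\le p-2+r$; $\|\alpha(f^{(l)}_{0,p-1}+f^{(l)}_{1,p})-(f^{(l)}_{0,0}+f^{(l)}_{1,0})\|<\varepsilon$ for all $l$; and $\|f^{(l)}_{r,j}a-af^{(l)}_{r,j}\|<\varepsilon$ for all $l,r,j$ and $a\in F$. -/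

import Mathlib

open Filter Topology
open scoped ENNReal ComplexOrder

namespace CentralSeq

noncomputable section

/-! ### The ultraproduct `A_ω` -/

section Ultraproduct

variable (A : Type*) [CStarAlgebra A] [Nontrivial A] (ω : Ultrafilter ℕ)

/-- `ℓ^∞(ℕ, A)`, the norm-bounded sequences in `A`. -/
abbrev LInfty : Type _ := lp (fun _ : ℕ => A) ∞

/-- `c_ω(A)`, the bounded sequences `(a_n)` with `lim_{n → ω} ‖a_n‖ = 0`, as an ideal of
`ℓ^∞(ℕ, A)`. -/
def nullSeq : Ideal (LInfty A) where
  carrier := {a | Tendsto (fun n => ‖a n‖) ω (𝓝 0)}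
  add_mem' := by
    intro a b ha hb
    refine squeeze_zero (fun n => norm_nonneg _) (fun n => ?_) (by simpa using ha.add hb)
    exact norm_add_le (a n) (b n)
  zero_mem' := by simp
  smul_mem' := by
    intro c a ha
    refine squeeze_zero (fun n => norm_nonneg _) (fun n => ?_) (by simpa using ha.const_mul ‖c‖)
    exact (norm_mul_le (c n) (a n)).trans
      (mul_le_mul_of_nonneg_right (lp.norm_apply_le_norm ENNReal.top_ne_zero c n) (norm_nonneg _))

instance : (nullSeq A ω).IsTwoSided where
  mul_mem_of_left := by
    intro a b ha
    refine squeeze_zero (fun n => norm_nonneg _) (fun n => ?_) (by simpa using ha.mul_const ‖b‖)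
    exact (norm_mul_le (a n) (b n)).trans
      (mul_le_mul_of_nonneg_left (lp.norm_apply_le_norm ENNReal.top_ne_zero b n) (norm_nonneg _))

/-- The ultraproduct `A_ω = ℓ^∞(ℕ, A) / c_ω(A)`. -/
def Ultraproduct : Type _ := LInfty A ⧸ nullSeq A ω

namespace Ultraproduct

instance : Ring (Ultraproduct A ω) := inferInstanceAs (Ring (LInfty A ⧸ nullSeq A ω))

instance : Algebra ℂ (Ultraproduct A ω) := inferInstanceAs (Algebra ℂ (LInfty A ⧸ nullSeq A ω))

variable {A}

/-- The class in `A_ω` of a bounded sequence. -/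
def mk : LInfty A →ₐ[ℂ] Ultraproduct A ω := Ideal.Quotient.mkₐ ℂ (nullSeq A ω)

lemma mk_surjective : Function.Surjective (mk ω : LInfty A → Ultraproduct A ω) :=
  Ideal.Quotient.mkₐ_surjective ℂ (nullSeq A ω)

variable {ω}

lemma mk_eq_mk {a b : LInfty A} :
    mk ω a = mk ω b ↔ Tendsto (fun n => ‖a n - b n‖) ω (𝓝 0) :=
  Ideal.Quotient.eq (I := nullSeq A ω)

lemma exists_tendsto {f : ℕ → ℝ} {C : ℝ} (h0 : ∀ n, 0 ≤ f n) (hC : ∀ n, f n ≤ C) :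
    ∃ L, Tendsto f ω (𝓝 L) := by
  obtain ⟨L, -, hL⟩ := (isCompact_Icc (a := (0 : ℝ)) (b := C)).ultrafilter_le_nhds (ω.map f)
    (by
      rw [Filter.le_principal_iff, Ultrafilter.mem_coe, Ultrafilter.mem_map]
      exact Filter.mem_of_superset Filter.univ_mem fun n _ => ⟨h0 n, hC n⟩)
  exact ⟨L, hL⟩

lemma isClosed_nullSeq : IsClosed (nullSeq A ω : Set (LInfty A)) := by
  refine isClosed_of_closure_subset fun a ha => ?_
  rw [Metric.mem_closure_iff] at ha
  change Tendsto (fun n => ‖a n‖) ω (𝓝 0)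
  rw [Metric.tendsto_nhds]
  intro ε hε
  obtain ⟨b, hb, hab⟩ := ha (ε / 2) (by positivity)
  have hb' : Tendsto (fun n => ‖b n‖) ω (𝓝 0) := hb
  filter_upwards [hb'.eventually_lt_const (half_pos hε)] with n hn
  have h1 : ‖a n - b n‖ ≤ ‖a - b‖ := lp.norm_apply_le_norm ENNReal.top_ne_zero (a - b) n
  rw [dist_eq_norm] at hab
  have h2 : ‖a n‖ ≤ ‖a n - b n‖ + ‖b n‖ := by simpa using norm_add_le (a n - b n) (b n)
  simp only [dist_zero_right, norm_norm]
  linarith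

instance : NormedAddCommGroup (Ultraproduct A ω) :=
  haveI : IsClosed (nullSeq A ω : Set (LInfty A)) := isClosed_nullSeq
  inferInstanceAs (NormedAddCommGroup (LInfty A ⧸ nullSeq A ω))

instance : CompleteSpace (Ultraproduct A ω) :=
  inferInstanceAs (CompleteSpace (LInfty A ⧸ nullSeq A ω))

lemma norm_mk_le (a : LInfty A) : ‖mk ω a‖ ≤ ‖a‖ :=
  Submodule.Quotient.norm_mk_le (S := nullSeq A ω) a

lemma exists_norm_lt (x : Ultraproduct A ω) {ε : ℝ} (hε : 0 < ε) :
    ∃ a : LInfty A, mk ω a = x ∧ ‖a‖ < ‖x‖ + ε :=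
  Submodule.Quotient.norm_mk_lt (S := nullSeq A ω) x hε

/-- The quotient norm on `A_ω` is `‖(a_n)‖ = lim_{n → ω} ‖a_n‖`. -/
lemma tendsto_norm_mk (a : LInfty A) : Tendsto (fun n => ‖a n‖) ω (𝓝 ‖mk ω a‖) := by
  classical
  obtain ⟨L, hL⟩ := exists_tendsto (ω := ω) (f := fun n => ‖a n‖) (C := ‖a‖)
    (fun n => norm_nonneg _) (fun n => lp.norm_apply_le_norm ENNReal.top_ne_zero a n)
  have hL0 : 0 ≤ L := ge_of_tendsto' hL fun n => norm_nonneg _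
  suffices h : ‖mk ω a‖ = L by rwa [h]
  apply le_antisymm
  · refine le_of_forall_pos_le_add fun ε hε => ?_
    let g : ℕ → A := fun n => if ‖a n‖ < L + ε then a n else 0
    have hg : ∀ n, ‖g n‖ ≤ L + ε := by
      intro n
      by_cases h : ‖a n‖ < L + ε
      · simpa [g, h] using h.le
      · simp only [g, h, if_false, norm_zero]
        positivity
    let b : LInfty A := ⟨g, memℓp_infty ⟨L + ε, by rintro _ ⟨n, rfl⟩; exact hg n⟩⟩
    have hab : mk ω a = mk ω b := by
      rw [mk_eq_mk]
      refine tendsto_const_nhds.congr' ?_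
      filter_upwards [hL.eventually_lt_const (show L < L + ε by linarith)] with n hn
      simp [b, g, hn]
    rw [hab]
    exact (norm_mk_le b).trans (lp.norm_le_of_forall_le (by positivity) hg)
  · refine le_of_forall_pos_le_add fun ε hε => ?_
    obtain ⟨b, hb, hlt⟩ := exists_norm_lt (mk ω a) hε
    have hb0 := mk_eq_mk.1 hb.symm
    have : Tendsto (fun n => ‖a n‖ - ‖a n - b n‖) ω (𝓝 L) := by simpa using hL.sub hb0
    refine (le_of_tendsto' this fun n => ?_).trans hlt.le
    have h1 : ‖a n‖ ≤ ‖a n - b n‖ + ‖b n‖ := by simpa using norm_add_le (a n - b n) (b n)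
    have h2 := lp.norm_apply_le_norm ENNReal.top_ne_zero b n
    linarith

instance : NormedRing (Ultraproduct A ω) where
  __ := (inferInstance : NormedAddCommGroup (Ultraproduct A ω))
  __ := (inferInstance : Ring (Ultraproduct A ω))
  norm_mul_le x y := by
    obtain ⟨a, rfl⟩ := mk_surjective ω x
    obtain ⟨b, rfl⟩ := mk_surjective ω y
    rw [← map_mul]
    exact le_of_tendsto_of_tendsto' (tendsto_norm_mk (a * b))
      ((tendsto_norm_mk a).mul (tendsto_norm_mk b)) fun n => norm_mul_le (a n) (b n)

instance : NormedAlgebra ℂ (Ultraproduct A ω) where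
  norm_smul_le c x := by
    obtain ⟨a, rfl⟩ := mk_surjective ω x
    rw [← map_smul]
    exact le_of_tendsto_of_tendsto' (tendsto_norm_mk (c • a))
      ((tendsto_norm_mk a).const_mul ‖c‖) fun n => norm_smul_le c (a n)

/-- A map on `A_ω` given by a map on bounded sequences that respects `c_ω(A)`-classes. -/
def lift₁ {β : Type*} (F : LInfty A → β) (hF : ∀ a b, mk ω a = mk ω b → F a = F b)
    (x : Ultraproduct A ω) : β :=
  Quotient.lift F (fun a b h => hF a b (Quotient.sound h)) x

@[simp]
lemma lift₁_mk {β : Type*} (F : LInfty A → β) (hF : ∀ a b, mk ω a = mk ω b → F a = F b)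
    (a : LInfty A) : lift₁ F hF (mk ω a) = F a := rfl

/-- The involution of `A_ω` is `(a_n)* = (a_n*)`. -/
instance : Star (Ultraproduct A ω) where
  star := lift₁ (fun a => mk ω (star a)) fun a b h => by
    rw [mk_eq_mk] at h ⊢
    refine h.congr fun n => ?_
    rw [← norm_star, star_sub]
    rfl

lemma star_mk (a : LInfty A) : star (mk ω a) = mk ω (star a) := rfl

instance : StarRing (Ultraproduct A ω) where
  star_involutive x := by
    obtain ⟨a, rfl⟩ := mk_surjective ω x
    simp [star_mk]
  star_mul x y := by
    obtain ⟨a, rfl⟩ := mk_surjective ω x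
    obtain ⟨b, rfl⟩ := mk_surjective ω y
    simp only [star_mk, ← map_mul, star_mul]
  star_add x y := by
    obtain ⟨a, rfl⟩ := mk_surjective ω x
    obtain ⟨b, rfl⟩ := mk_surjective ω y
    simp only [star_mk, ← map_add, star_add]

instance : StarModule ℂ (Ultraproduct A ω) where
  star_smul c x := by
    obtain ⟨a, rfl⟩ := mk_surjective ω x
    simp only [star_mk, ← map_smul, star_smul]

instance : CStarRing (Ultraproduct A ω) where
  norm_mul_self_le x := by
    obtain ⟨a, rfl⟩ := mk_surjective ω x
    rw [star_mk, ← map_mul]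
    exact le_of_tendsto_of_tendsto' ((tendsto_norm_mk a).mul (tendsto_norm_mk a))
      (tendsto_norm_mk (star a * a)) fun n => (CStarRing.norm_star_mul_self (x := a n)).ge

instance : CStarAlgebra (Ultraproduct A ω) where

/-- The usual order of the C⋆-algebra `A_ω`. -/
instance : PartialOrder (Ultraproduct A ω) := CStarAlgebra.spectralOrder _

instance : StarOrderedRing (Ultraproduct A ω) := CStarAlgebra.spectralOrderedRing _

variable (ω)

/-- The constant sequence with value `a`. -/
def constSeq (a : A) : LInfty A :=
  ⟨fun _ => a, memℓp_infty ⟨‖a‖, by rintro _ ⟨n, rfl⟩; rfl⟩⟩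

/-- The embedding of `A` into `A_ω` by constant sequences. -/
def const (a : A) : Ultraproduct A ω := mk ω (constSeq a)

/-- The sequence `(α(a_n))` for a bounded sequence `(a_n)`. -/
def mapSeq (α : A ≃⋆ₐ[ℂ] A) (a : LInfty A) : LInfty A :=
  ⟨fun n => α (a n), memℓp_infty ⟨‖a‖, by
    rintro _ ⟨n, rfl⟩
    exact (NonUnitalStarAlgHom.norm_apply_le α (a n)).trans
      (lp.norm_apply_le_norm ENNReal.top_ne_zero a n)⟩⟩

/-- The automorphism `α_ω` of `A_ω`, `α_ω((a_n)) = (α(a_n))`, as a map. -/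
def mapFun (α : A ≃⋆ₐ[ℂ] A) : Ultraproduct A ω → Ultraproduct A ω :=
  lift₁ (fun a => mk ω (mapSeq α a)) fun a b h => by
    rw [mk_eq_mk] at h ⊢
    refine squeeze_zero (fun n => norm_nonneg _) (fun n => ?_) h
    have := NonUnitalStarAlgHom.norm_apply_le α (a n - b n)
    rwa [map_sub] at this

lemma mapFun_mk (α : A ≃⋆ₐ[ℂ] A) (a : LInfty A) : mapFun ω α (mk ω a) = mk ω (mapSeq α a) := rfl

/-- The automorphism `α_ω` of `A_ω` induced by an automorphism `α` of `A`. -/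
def map (α : A ≃⋆ₐ[ℂ] A) : Ultraproduct A ω ≃⋆ₐ[ℂ] Ultraproduct A ω where
  toFun := mapFun ω α
  invFun := mapFun ω α.symm
  left_inv x := by
    obtain ⟨a, rfl⟩ := mk_surjective ω x
    rw [mapFun_mk, mapFun_mk]
    congr 1
    ext n
    exact α.symm_apply_apply (a n)
  right_inv x := by
    obtain ⟨a, rfl⟩ := mk_surjective ω x
    rw [mapFun_mk, mapFun_mk]
    congr 1
    ext n
    exact α.apply_symm_apply (a n)
  map_mul' x y := by
    obtain ⟨a, rfl⟩ := mk_surjective ω x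
    obtain ⟨b, rfl⟩ := mk_surjective ω y
    rw [← map_mul, mapFun_mk, mapFun_mk, mapFun_mk, ← map_mul]
    congr 1
    ext n
    exact map_mul α (a n) (b n)
  map_add' x y := by
    obtain ⟨a, rfl⟩ := mk_surjective ω x
    obtain ⟨b, rfl⟩ := mk_surjective ω y
    rw [← map_add, mapFun_mk, mapFun_mk, mapFun_mk, ← map_add]
    congr 1
    ext n
    exact map_add α (a n) (b n)
  map_smul' c x := by
    obtain ⟨a, rfl⟩ := mk_surjective ω x
    rw [← map_smul, mapFun_mk, mapFun_mk, ← map_smul]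
    congr 1
    ext n
    exact map_smul α c (a n)
  map_star' x := by
    obtain ⟨a, rfl⟩ := mk_surjective ω x
    rw [star_mk, mapFun_mk, mapFun_mk, star_mk]
    congr 1
    ext n
    exact map_star α (a n)

end Ultraproduct

/-- The central sequence algebra `F(A) = A_ω ∩ A'`. -/
def centralSequenceAlgebra : StarSubalgebra ℂ (Ultraproduct A ω) :=
  StarSubalgebra.centralizer ℂ (Set.range (Ultraproduct.const ω : A → Ultraproduct A ω))

end Ultraproduct

/-! ### Tracial states, the uniform 2-norm and the trace-kernel ideal -/

section Traces

set_option linter.unusedSectionVars false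

variable (A : Type*) [CStarAlgebra A] [PartialOrder A] [StarOrderedRing A]

/-- The trace space `T(A)`: the tracial states of `A`. -/
def traceSpace : Set (A →ₚ[ℂ] ℂ) := {τ | τ 1 = 1 ∧ ∀ a b : A, τ (a * b) = τ (b * a)}

variable {A}

/-- The uniform 2-norm `‖a‖_{2,u} = sup_{τ ∈ T(A)} τ(a* a)^{1/2}`. -/
def uniformTwoNorm (a : A) : ℝ := ⨆ τ : traceSpace A, √((τ : A →ₚ[ℂ] ℂ) (star a * a)).re

lemma sqrt_trace_le (τ : traceSpace A) (a : A) :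
    √((τ : A →ₚ[ℂ] ℂ) (star a * a)).re ≤ ‖a‖ := by
  have h := ((τ : A →ₚ[ℂ] ℂ).leftMulMapPreGNS a).le_of_opNorm_le
    (LinearMap.mkContinuous_norm_le _ (norm_nonneg a) _) ((τ : A →ₚ[ℂ] ℂ).toPreGNS 1)
  rw [PositiveLinearMap.preGNS_norm_def, PositiveLinearMap.preGNS_norm_def] at h
  simpa [τ.2.1] using h

lemma sqrt_trace_sub_le (τ : traceSpace A) (a b : A) :
    √((τ : A →ₚ[ℂ] ℂ) (star a * a)).re ≤
      √((τ : A →ₚ[ℂ] ℂ) (star b * b)).re + ‖a - b‖ := by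
  have h := norm_add_le ((τ : A →ₚ[ℂ] ℂ).toPreGNS b) ((τ : A →ₚ[ℂ] ℂ).toPreGNS (a - b))
  rw [← map_add, PositiveLinearMap.preGNS_norm_def, PositiveLinearMap.preGNS_norm_def,
    PositiveLinearMap.preGNS_norm_def] at h
  simp only [PositiveLinearMap.ofPreGNS_toPreGNS, add_sub_cancel] at h
  have := sqrt_trace_le τ (a - b)
  linarith

lemma bddAbove_sqrt_trace (a : A) :
    BddAbove (Set.range fun τ : traceSpace A => √((τ : A →ₚ[ℂ] ℂ) (star a * a)).re) :=
  ⟨‖a‖, by rintro _ ⟨τ, rfl⟩; exact sqrt_trace_le τ a⟩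

lemma uniformTwoNorm_nonneg (a : A) : 0 ≤ uniformTwoNorm a :=
  Real.iSup_nonneg fun _ => Real.sqrt_nonneg _

lemma uniformTwoNorm_le (a : A) : uniformTwoNorm a ≤ ‖a‖ :=
  Real.iSup_le (fun τ => sqrt_trace_le τ a) (norm_nonneg a)

lemma uniformTwoNorm_le_add (a b : A) : uniformTwoNorm a ≤ uniformTwoNorm b + ‖a - b‖ :=
  Real.iSup_le (fun τ => (sqrt_trace_sub_le τ a b).trans
    (add_le_add_left (le_ciSup (bddAbove_sqrt_trace b) τ) _))
    (add_nonneg (uniformTwoNorm_nonneg b) (norm_nonneg _))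

variable [Nontrivial A] {ω : Ultrafilter ℕ}

lemma exists_tendsto_uniformTwoNorm (a : LInfty A) :
    ∃ L, Tendsto (fun n => uniformTwoNorm (a n)) ω (𝓝 L) :=
  Ultraproduct.exists_tendsto (C := ‖a‖) (fun n => uniformTwoNorm_nonneg (a n))
    fun n => (uniformTwoNorm_le (a n)).trans (lp.norm_apply_le_norm ENNReal.top_ne_zero a n)

/-- The 2-norm on `A_ω`: `‖(a_n)‖_{2,ω} = lim_{n → ω} ‖a_n‖_{2,u}`. -/
def twoNorm : Ultraproduct A ω → ℝ :=
  Ultraproduct.lift₁ (fun a => limUnder (ω : Filter ℕ) fun n => uniformTwoNorm (a n))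
    fun a b h => by
      rw [Ultraproduct.mk_eq_mk] at h
      obtain ⟨L, hL⟩ := exists_tendsto_uniformTwoNorm (ω := ω) a
      rw [hL.limUnder_eq]
      refine (Tendsto.limUnder_eq ?_).symm
      refine tendsto_of_tendsto_of_dist hL (squeeze_zero (fun n => dist_nonneg) (fun n => ?_) h)
      rw [Real.dist_eq, abs_le]
      have h1 := uniformTwoNorm_le_add (a n) (b n)
      have h2 := uniformTwoNorm_le_add (b n) (a n)
      rw [norm_sub_rev] at h2
      constructor <;> linarith

/-- The limit in the definition of `‖·‖_{2,ω}` exists. -/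
lemma tendsto_twoNorm (a : LInfty A) :
    Tendsto (fun n => uniformTwoNorm (a n)) ω (𝓝 (twoNorm (Ultraproduct.mk ω a))) :=
  tendsto_nhds_limUnder (exists_tendsto_uniformTwoNorm a)

variable (A ω)

/-- The trace-kernel ideal `J_A = {(a_n) : lim_{n → ω} ‖a_n‖_{2,u} = 0}`, as a subset of `A_ω`. -/
def traceKernel : Set (Ultraproduct A ω) := {x | twoNorm x = 0}

end Traces

/-! ### Simplicity, property (SI), the approximate Rokhlin property and the Rokhlin dimension -/

section Properties

/-- A nonzero C⋆-algebra is simple if `0` and `A` are its only closed two-sided ideals. -/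
def IsSimpleCStar (A : Type*) [CStarAlgebra A] : Prop :=
  Nontrivial A ∧ ∀ I : TwoSidedIdeal A, IsClosed (I : Set A) → I = ⊥ ∨ I = ⊤

variable (A : Type*) [CStarAlgebra A] [PartialOrder A] [StarOrderedRing A] [Nontrivial A]
  (ω : Ultrafilter ℕ)

variable {A} in
/-- `x` is a positive contraction lying in `F(A)`. -/
def IsCentralPosContraction (x : Ultraproduct A ω) : Prop :=
  x ∈ centralSequenceAlgebra A ω ∧ 0 ≤ x ∧ ‖x‖ ≤ 1

/-- Property (SI): for all positive contractions `e, f ∈ F(A)` with `e ∈ J_A` and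
`sup_n ‖1 - f ^ n‖_{2,ω} < 1` there is `s ∈ F(A)` with `f s = s` and `s* s = e`. -/
def PropertySI : Prop :=
  ∀ e f : Ultraproduct A ω, IsCentralPosContraction ω e → IsCentralPosContraction ω f →
    e ∈ traceKernel A ω → (⨆ n : ℕ, twoNorm (1 - f ^ n)) < 1 →
    ∃ s ∈ centralSequenceAlgebra A ω, f * s = s ∧ star s * s = e

variable {A}

/-- The approximate Rokhlin property of an automorphism `α`. The towers are indexed by
`0, …, n - 1`, and `k + 1` in `Fin n` is taken modulo `n`. -/
def ApproxRokhlin (α : A ≃⋆ₐ[ℂ] A) : Prop :=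
  ∀ (n : ℕ) [NeZero n], ∃ f : Fin n → Ultraproduct A ω,
    (∀ k, IsCentralPosContraction ω (f k)) ∧
    (∀ k, Ultraproduct.map ω α (f k) = f (k + 1)) ∧
    (∀ k l, k ≠ l → f k * f l = 0) ∧
    1 - ∑ k, f k ∈ traceKernel A ω ∩ (centralSequenceAlgebra A ω : Set (Ultraproduct A ω)) ∧
    (⨆ m : ℕ, twoNorm (1 - f 0 ^ m)) < 1

/-- The towers required for the `ℤ`-action generated by `α` to have Rokhlin dimension at most `d`:
for each colour `l`, a tower `f l 0 0, …, f l 0 (p - 1)` and a tower `f l 1 0, …, f l 1 p`. Values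
`f l r j` with `j ≥ p + r` play no role. -/
def HasRokhlinTowers {A : Type*} [CStarAlgebra A] [PartialOrder A] [StarOrderedRing A]
    (α : A ≃⋆ₐ[ℂ] A) (d : ℕ) : Prop :=
  ∀ (F : Finset A) (p : ℕ) (ε : ℝ), 0 < p → 0 < ε →
    ∃ f : Fin (d + 1) → Fin 2 → ℕ → A,
      (∀ (l : Fin (d + 1)) (r : Fin 2) (j : ℕ), j < p + r → 0 ≤ f l r j ∧ ‖f l r j‖ ≤ 1) ∧
      (∀ (l : Fin (d + 1)) (q r : Fin 2) (i j : ℕ), i < p + q → j < p + r → (q, i) ≠ (r, j) →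
        ‖f l q i * f l r j‖ < ε) ∧
      ‖(∑ l : Fin (d + 1), ∑ r : Fin 2, ∑ j ∈ Finset.range (p + r), f l r j) - 1‖ < ε ∧
      (∀ (l : Fin (d + 1)) (r : Fin 2) (j : ℕ), j + 1 < p + r → ‖α (f l r j) - f l r (j + 1)‖ < ε) ∧
      (∀ l, ‖α (f l 0 (p - 1) + f l 1 p) - (f l 0 0 + f l 1 0)‖ < ε) ∧
      (∀ (l : Fin (d + 1)) (r : Fin 2) (j : ℕ), j < p + r → ∀ a ∈ F,
        ‖f l r j * a - a * f l r j‖ < ε)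

/-- The Rokhlin dimension of (the `ℤ`-action generated by) `α`: the least `d` admitting such towers,
and `⊤` if there is none. -/
def rokhlinDim {A : Type*} [CStarAlgebra A] [PartialOrder A] [StarOrderedRing A]
    (α : A ≃⋆ₐ[ℂ] A) : ℕ∞ :=
  ⨅ (d : ℕ) (_ : HasRokhlinTowers α d), (d : ℕ∞)

end Properties

end

end CentralSeq

open CentralSeq

/-! Let `e = 1 - ∑ φ k` be the defect of an approximate Rokhlin tower of height `n`. Property (SI),
applied to `e` and `φ 0`, gives `s` with `s* s = e` and `φ 0 * s = s`. As `α` fixes `e` and permutes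
the `φ k`, the iterates `α^[k] s`, `k < n`, have Gram matrix `e` times the identity. The defect is
absorbed by rearranging these copies spectrally.

Take `n = N * L`. Averaging the iterates along progressions of step `N` with weight `L^{-1/2}` gives
`g 0, …, g (N - 1)` with the same Gram matrix, shifted by `α`, and with `g N - g 0` of norm at most
`2 / √L`. Their Fourier transform consists of approximate eigenvectors `x p`, one for each `N`-th
root of unity, and `X = ∑ g i (g i)* = ∑ x p (x p)*` by Parseval. Cutting `X` out of the columns of
`φ` leaves a tower `a` of height `m` with sum `1 - e - X` (`DefectTower.exists_eigenvectors`).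

What remains is `e + X = √e √e* + ∑ x p (x p)*`, a sum over `N + 1` approximate eigenvectors in
which the eigenvalue `1` occurs twice. With `N = m * K + m` a multiple of `m + 1`, the vector `√e`
and `m` of the `x p` realise the `(m + 1)`-th roots of unity, and a Fourier transform turns them
into a tower `c` of height `m + 1`. The other `m * K` eigenvalues are within `2πm / N` of the `m *
K`-th roots of unity; the resulting tower of height `m * K` folds to a tower `b` of height `m`
(`exists_complementary_towers`). Errors are measured by the row norm `‖∑ u i (u i)*‖`, which Fourier
transforms preserve, so the estimates do not grow with `N`.

These towers are shifted by `α` only up to `ε`. Lifting them to `A` and choosing better ones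
coordinate by coordinate along a dense sequence gives exact relations (`exists_exact_partition`).
The approximate towers in `A` also bound the Rokhlin dimension. -/

namespace RokhlinTower

/-! ### Norm estimates for rows over a C⋆-algebra -/

section Rows

lemma norm_sum_mul_star_self_le_of_norm_le {D ι : Type*} [CStarAlgebra D] (T : Finset ι) (x : ι → D) {δ : ℝ}
    (hx : ∀ i ∈ T, ‖x i‖ ≤ δ) : ‖∑ i ∈ T, x i * star (x i)‖ ≤ T.card * δ ^ 2 := by
  refine (norm_sum_le _ _).trans ?_
  rw [← nsmul_eq_mul]
  refine Finset.sum_le_card_nsmul _ _ _ fun i hi => ?_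
  rw [CStarRing.norm_self_mul_star, ← sq]
  exact pow_le_pow_left₀ (norm_nonneg _) (hx i hi) 2

variable {D : Type*} [CStarAlgebra D] [PartialOrder D] [StarOrderedRing D]

lemma sum_mul_star_self_nonneg {ι : Type*} (T : Finset ι) (x : ι → D) :
    0 ≤ ∑ i ∈ T, x i * star (x i) :=
  Finset.sum_nonneg fun i _ => mul_star_self_nonneg (x i)

/-- The Cauchy–Schwarz inequality for rows over a C⋆-algebra. -/
lemma norm_sum_mul_star_le {ι : Type*} (T : Finset ι) (x y : ι → D) {r s : ℝ} (hr : 0 ≤ r)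
    (hs : 0 ≤ s) (hx : ‖∑ i ∈ T, x i * star (x i)‖ ≤ r ^ 2)
    (hy : ‖∑ i ∈ T, y i * star (y i)‖ ≤ s ^ 2) :
    ‖∑ i ∈ T, x i * star (y i)‖ ≤ r * s := by
  classical
  let X : WithCStarModule D ((i : T) → D) := (WithCStarModule.equiv D _).symm fun i => x i
  let Y : WithCStarModule D ((i : T) → D) := (WithCStarModule.equiv D _).symm fun i => y i
  have hin : ∀ u v : ι → D, inner D ((WithCStarModule.equiv D ((i : T) → D)).symm fun i => u i)
      ((WithCStarModule.equiv D ((i : T) → D)).symm fun i => v i) = ∑ i ∈ T, v i * star (u i) := by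
    intro u v
    rw [WithCStarModule.pi_inner, ← Finset.sum_coe_sort T]
    rfl
  have h := CStarModule.norm_inner_le (A := D) (x := Y) (y := X)
  rw [hin y x] at h
  have hX : ‖X‖ ≤ r := by
    refine abs_le_of_sq_le_sq' ?_ hr |>.2
    rw [CStarModule.norm_sq_eq (A := D), hin x x]
    exact hx
  have hY : ‖Y‖ ≤ s := by
    refine abs_le_of_sq_le_sq' ?_ hs |>.2
    rw [CStarModule.norm_sq_eq (A := D), hin y y]
    exact hy
  calc _ ≤ ‖Y‖ * ‖X‖ := h
    _ ≤ s * r := mul_le_mul hY hX (CStarModule.norm_nonneg (A := D)) hs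
    _ = r * s := mul_comm _ _

lemma norm_sum_mul_star_self_mono {ι : Type*} {T U : Finset ι} (h : T ⊆ U) (x : ι → D) :
    ‖∑ i ∈ T, x i * star (x i)‖ ≤ ‖∑ i ∈ U, x i * star (x i)‖ :=
  CStarAlgebra.norm_le_norm_of_nonneg_of_le (sum_mul_star_self_nonneg T x)
    (Finset.sum_le_sum_of_subset_of_nonneg h fun i _ _ => mul_star_self_nonneg (x i))

/-- A perturbation of a contractive row perturbs the row times its adjoint little. -/
lemma norm_sum_mul_star_self_sub_le {ι : Type*} (T : Finset ι) (u v : ι → D) {δ : ℝ} (hδ : 0 ≤ δ)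
    (hv : ‖∑ i ∈ T, v i * star (v i)‖ ≤ 1)
    (huv : ‖∑ i ∈ T, (u i - v i) * star (u i - v i)‖ ≤ δ ^ 2) :
    ‖∑ i ∈ T, u i * star (u i) - ∑ i ∈ T, v i * star (v i)‖ ≤ 2 * δ + δ ^ 2 := by
  have h1 := norm_sum_mul_star_le T (fun i => u i - v i) v hδ zero_le_one huv (by simpa using hv)
  have h2 := norm_sum_mul_star_le T v (fun i => u i - v i) zero_le_one hδ (by simpa using hv) huv
  have : ∑ i ∈ T, u i * star (u i) - ∑ i ∈ T, v i * star (v i) =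
      ∑ i ∈ T, (u i - v i) * star (v i) + ∑ i ∈ T, v i * star (u i - v i) +
        ∑ i ∈ T, (u i - v i) * star (u i - v i) := by
    rw [← Finset.sum_sub_distrib, ← Finset.sum_add_distrib, ← Finset.sum_add_distrib]
    refine Finset.sum_congr rfl fun i _ => ?_
    simp only [star_sub]
    noncomm_ring
  rw [this]
  refine (norm_add₃_le).trans ?_
  linarith

/-- Positivity of `(x i - y i) (x i - y i)*` bounds the mixed terms. -/
lemma norm_sum_add_mul_star_self_le {ι : Type*} (T : Finset ι) (x y : ι → D) :
    ‖∑ i ∈ T, (x i + y i) * star (x i + y i)‖ ≤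
      2 * ‖∑ i ∈ T, x i * star (x i)‖ + 2 * ‖∑ i ∈ T, y i * star (y i)‖ := by
  have h : ∑ i ∈ T, (x i + y i) * star (x i + y i) ≤
      2 * ∑ i ∈ T, x i * star (x i) + 2 * ∑ i ∈ T, y i * star (y i) := by
    rw [Finset.mul_sum, Finset.mul_sum, ← Finset.sum_add_distrib]
    refine Finset.sum_le_sum fun i _ => ?_
    rw [← sub_nonneg]
    convert mul_star_self_nonneg (x i - y i) using 1
    simp only [star_add, star_sub]
    noncomm_ring
  refine (CStarAlgebra.norm_le_norm_of_nonneg_of_le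
    (sum_mul_star_self_nonneg T fun i => x i + y i) h).trans ((norm_add_le _ _).trans ?_)
  simp only [two_mul]
  gcongr <;> exact norm_add_le _ _

/-- The bound does not see the number of terms. This is what makes moving many eigenvalues
simultaneously affordable. -/
lemma norm_sum_smul_mul_star_self_le {ι : Type*} (T : Finset ι) (x : ι → D) (c : ι → ℂ) {δ : ℝ}
    (hc : ∀ i ∈ T, ‖c i‖ ≤ δ) (hx : ‖∑ i ∈ T, x i * star (x i)‖ ≤ 1) :
    ‖∑ i ∈ T, (c i • x i) * star (c i • x i)‖ ≤ δ ^ 2 := by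
  have h : ∑ i ∈ T, (c i • x i) * star (c i • x i) ≤ (δ ^ 2) • ∑ i ∈ T, x i * star (x i) := by
    rw [Finset.smul_sum]
    refine Finset.sum_le_sum fun i hi => ?_
    have : (c i • x i) * star (c i • x i) = (‖c i‖ ^ 2) • (x i * star (x i)) := by
      rw [star_smul, smul_mul_smul_comm, Complex.star_def, Complex.mul_conj']
      norm_cast
    rw [this]
    exact smul_le_smul_of_nonneg_right (pow_le_pow_left₀ (norm_nonneg _) (hc i hi) 2)
      (mul_star_self_nonneg _)
  refine (CStarAlgebra.norm_le_norm_of_nonneg_of_le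
    (sum_mul_star_self_nonneg T fun i => c i • x i) h).trans ?_
  rw [norm_smul, Real.norm_of_nonneg (sq_nonneg δ)]
  exact mul_le_of_le_one_right (sq_nonneg δ) hx

lemma le_one_of_mul_self_le {a : D} (ha : 0 ≤ a) (h : a * a ≤ a) : a ≤ 1 := by
  rw [← CStarAlgebra.norm_le_one_iff_of_nonneg a ha]
  have hs : IsSelfAdjoint a := .of_nonneg ha
  have h0 : 0 ≤ a * a := by simpa [hs.star_eq] using mul_star_self_nonneg a
  have h1 := CStarAlgebra.norm_le_norm_of_nonneg_of_le h0 h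
  have h2 : ‖a * a‖ = ‖a‖ * ‖a‖ := by simpa [hs.star_eq] using CStarRing.norm_self_mul_star (x := a)
  rw [h2] at h1
  nlinarith [norm_nonneg a]

lemma mul_self_le_of_le_one {a : D} (ha : 0 ≤ a) (h : a ≤ 1) : a * a ≤ a := by
  have hs := CFC.sqrt_nonneg a
  have h1 := star_left_conjugate_le_conjugate h (CFC.sqrt a)
  have h2 := CFC.sqrt_mul_sqrt_self a ha
  have h3 : star (CFC.sqrt a) = CFC.sqrt a := (IsSelfAdjoint.of_nonneg hs).star_eq
  rw [h3, mul_one, h2] at h1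
  calc a * a = CFC.sqrt a * CFC.sqrt a * (CFC.sqrt a * CFC.sqrt a) := by rw [h2]
    _ = CFC.sqrt a * (CFC.sqrt a * CFC.sqrt a) * CFC.sqrt a := by simp only [mul_assoc]
    _ = CFC.sqrt a * a * CFC.sqrt a := by rw [h2]
    _ ≤ a := h1

/-- A family of elements whose Gram matrix is `e` times the identity. -/
def IsGramDiagonal {ι : Type*} (e : D) (T : Set ι) (x : ι → D) : Prop :=
  (∀ i ∈ T, star (x i) * x i = e) ∧ ∀ i ∈ T, ∀ j ∈ T, i ≠ j → star (x i) * x j = 0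

/-- The Gram relations give `P * P = ∑ x i e (x i)* ≤ P` for `P = ∑ x i (x i)*`, which forces `P ≤
1`. -/
lemma IsGramDiagonal.sum_le_one {ι : Type*} {e : D} (he1 : e ≤ 1) {T : Finset ι}
    {x : ι → D} (hx : IsGramDiagonal e (T : Set ι) x) : ∑ i ∈ T, x i * star (x i) ≤ 1 := by
  refine le_one_of_mul_self_le (sum_mul_star_self_nonneg T x) ?_
  have : (∑ i ∈ T, x i * star (x i)) * ∑ i ∈ T, x i * star (x i) =
      ∑ i ∈ T, x i * e * star (x i) := by
    rw [Finset.sum_mul_sum]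
    refine Finset.sum_congr rfl fun i hi => ?_
    rw [Finset.sum_eq_single_of_mem i hi]
    · rw [← hx.1 i hi]; simp only [mul_assoc]
    · intro j hj hji
      rw [mul_assoc, ← mul_assoc (star (x i)), hx.2 i hi j hj hji.symm, zero_mul, mul_zero]
  rw [this]
  refine Finset.sum_le_sum fun i _ => ?_
  simpa using star_right_conjugate_le_conjugate he1 (x i)

lemma IsGramDiagonal.norm_sum_le_one {ι : Type*} {e : D} (he1 : e ≤ 1) {T : Finset ι}
    {x : ι → D} (hx : IsGramDiagonal e (T : Set ι) x) : ‖∑ i ∈ T, x i * star (x i)‖ ≤ 1 :=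
  (CStarAlgebra.norm_le_one_iff_of_nonneg _ (sum_mul_star_self_nonneg T x)).2 (hx.sum_le_one he1)

/-- A sum of mutually orthogonal positive contractions is a contraction. -/
lemma sum_le_one_of_orthogonal {ι : Type*} (T : Finset ι) (f : ι → D) (h0 : ∀ i, 0 ≤ f i)
    (h1 : ∀ i, f i ≤ 1) (h : ∀ i j, i ≠ j → f i * f j = 0) : ∑ i ∈ T, f i ≤ 1 := by
  refine le_one_of_mul_self_le (Finset.sum_nonneg fun i _ => h0 i) ?_
  rw [Finset.sum_mul_sum]
  refine Finset.sum_le_sum fun i hi => ?_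
  rw [Finset.sum_eq_single_of_mem i hi fun j _ hji => h i j hji.symm]
  exact mul_self_le_of_le_one (h0 i) (h1 i)

end Rows

/-! ### Folding a long cyclic tower to a shorter one -/

section ColumnSums

variable {M : Type*} [AddCommGroup M]

/-- The sum of `h` over the first `K` terms of the progression `j, j + m, j + 2 m, …`. -/
def columnSum (m K : ℕ) (h : ℕ → M) (j : ℕ) : M := ∑ r ∈ Finset.range K, h (j + m * r)

/-- A shift by `m` drops the term `h j` and adds `h (j + m * K)`, which equals it. -/
lemma columnSum_periodic {m K : ℕ} {h : ℕ → M} (hh : Function.Periodic h (m * K)) :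
    Function.Periodic (columnSum m K h) m := by
  intro j
  have h1 := Finset.sum_range_succ (fun r => h (j + m * r)) K
  have h2 := Finset.sum_range_succ' (fun r => h (j + m * r)) K
  rw [hh j, h2] at h1
  have h3 := add_right_cancel h1
  unfold columnSum
  rw [← h3]
  exact Finset.sum_congr rfl fun r _ => congrArg h (by ring)

lemma sum_columnSum (m K : ℕ) (h : ℕ → M) :
    ∑ j ∈ Finset.range m, columnSum m K h j = ∑ k ∈ Finset.range (m * K), h k := by
  induction K with
  | zero => simp [columnSum]
  | succ K ih =>
    rw [Nat.mul_succ, Finset.sum_range_add, ← ih, ← Finset.sum_add_distrib]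
    exact Finset.sum_congr rfl fun j _ => by
      rw [columnSum, Finset.sum_range_succ, add_comm (m * K) j, columnSum]

lemma sum_range_succ_eq_of_periodic {n : ℕ} {h : ℕ → M} (hh : Function.Periodic h n) :
    ∑ k ∈ Finset.range n, h (k + 1) = ∑ k ∈ Finset.range n, h k := by
  have h1 := Finset.sum_range_succ h n
  rw [Finset.sum_range_succ', hh.eq] at h1
  exact add_right_cancel h1

end ColumnSums

/-! ### The discrete Fourier transform of a finite family -/

section Dft

variable {D : Type*} [CStarAlgebra D]

/-- The discrete Fourier transform with respect to the `n`-th root of unity `ξ`. -/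
noncomputable def dft (ξ : ℂ) (n : ℕ) (g : ℕ → D) (k : ℕ) : D :=
  ((√(n : ℝ) : ℝ) : ℂ)⁻¹ • ∑ p ∈ Finset.range n, ξ ^ (k * p) • g p

lemma sqrt_inv_mul_star (n : ℕ) :
    ((√(n : ℝ) : ℝ) : ℂ)⁻¹ * star (((√(n : ℝ) : ℝ) : ℂ)⁻¹) = (n : ℂ)⁻¹ := by
  rw [Complex.star_def, map_inv₀, Complex.conj_ofReal, ← mul_inv, ← Complex.ofReal_mul,
    Real.mul_self_sqrt (Nat.cast_nonneg n), Complex.ofReal_natCast]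

lemma sum_pow_mul_star_pow {ξ : ℂ} {n : ℕ} (hξ : IsPrimitiveRoot ξ n) {p q : ℕ} (hp : p < n)
    (hq : q < n) : ∑ k ∈ Finset.range n, ξ ^ (k * p) * star (ξ ^ (k * q)) =
      if p = q then (n : ℂ) else 0 := by
  have hn : n ≠ 0 := by omega
  have hnorm : ‖ξ‖ = 1 := hξ.norm'_eq_one hn
  have hξ0 : ξ ≠ 0 := hξ.ne_zero hn
  have hstar : star ξ = ξ⁻¹ := by
    rw [Complex.inv_def, Complex.normSq_eq_norm_sq, hnorm]; simp
  have hterm : ∀ k, ξ ^ (k * p) * star (ξ ^ (k * q)) = (ξ ^ p * (ξ ^ q)⁻¹) ^ k := by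
    intro k
    rw [star_pow, hstar, mul_pow, inv_pow, inv_pow, ← pow_mul, ← pow_mul, mul_comm p, mul_comm q]
  simp only [hterm]
  split_ifs with h
  · subst h
    simp [pow_ne_zero p hξ0]
  · have hz : ξ ^ p * (ξ ^ q)⁻¹ - 1 ≠ 0 := by
      intro h0
      have : ξ ^ p = ξ ^ q := by
        rw [sub_eq_zero, mul_inv_eq_one₀ (pow_ne_zero _ hξ0)] at h0
        exact h0
      exact h (hξ.pow_inj hp hq this)
    have h1 := mul_geom_sum (ξ ^ p * (ξ ^ q)⁻¹) n
    have h2 : (ξ ^ p * (ξ ^ q)⁻¹) ^ n = 1 := by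
      rw [mul_pow, inv_pow, ← pow_mul, ← pow_mul, mul_comm p, mul_comm q, pow_mul, pow_mul,
        hξ.pow_eq_one]
      simp
    rw [h2, sub_self] at h1
    exact (mul_eq_zero.1 h1).resolve_left hz

lemma dft_periodic {ξ : ℂ} {n : ℕ} (hξ : ξ ^ n = 1) (g : ℕ → D) :
    Function.Periodic (dft ξ n g) n := by
  intro k
  simp only [dft, add_mul, pow_add, pow_mul ξ n, hξ, one_pow, mul_one]

/-- Translation corresponds to multiplication by `ξ ^ p`, so eigenvectors for the powers of `ξ`
transform into a sequence shifted by `α`. -/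
lemma dft_add_one (ξ : ℂ) (n : ℕ) (g : ℕ → D) (k : ℕ) :
    dft ξ n g (k + 1) = dft ξ n (fun p => ξ ^ p • g p) k := by
  simp only [dft, add_mul, one_mul, pow_add, mul_smul]

lemma dft_sub (ξ : ℂ) (n : ℕ) (g h : ℕ → D) (k : ℕ) :
    dft ξ n (fun p => g p - h p) k = dft ξ n g k - dft ξ n h k := by
  simp only [dft, smul_sub, Finset.sum_sub_distrib]

lemma map_dft (α : D ≃⋆ₐ[ℂ] D) (ξ : ℂ) (n : ℕ) (g : ℕ → D) (k : ℕ) :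
    α (dft ξ n g k) = dft ξ n (fun p => α (g p)) k := by
  simp only [dft, map_smul, map_sum]

lemma dft_mem (S : StarSubalgebra ℂ D) (ξ : ℂ) {n : ℕ} {g : ℕ → D} (hg : ∀ p < n, g p ∈ S)
    (k : ℕ) : dft ξ n g k ∈ S :=
  S.smul_mem (sum_mem fun p hp => S.smul_mem (hg p (Finset.mem_range.1 hp)) _) _

lemma star_dft_mul_dft_eq_zero (ξ η : ℂ) {n l : ℕ} {g h : ℕ → D}
    (hgh : ∀ p < n, ∀ q < l, star (g p) * h q = 0) (i j : ℕ) :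
    star (dft ξ n g i) * dft η l h j = 0 := by
  have : (∑ p ∈ Finset.range n, star (ξ ^ (i * p) • g p)) *
      ∑ q ∈ Finset.range l, η ^ (j * q) • h q = 0 := by
    rw [Finset.sum_mul_sum]
    refine Finset.sum_eq_zero fun p hp => Finset.sum_eq_zero fun q hq => ?_
    rw [star_smul, smul_mul_smul_comm, hgh p (Finset.mem_range.1 hp) q (Finset.mem_range.1 hq),
      smul_zero]
  rw [dft, dft, star_smul, smul_mul_smul_comm, star_sum, this, smul_zero]

/-- Parseval's identity: the discrete Fourier transform is given by a unitary matrix. -/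
lemma sum_dft_mul_star {ξ : ℂ} {n : ℕ} (hξ : IsPrimitiveRoot ξ n) (g : ℕ → D) :
    ∑ k ∈ Finset.range n, dft ξ n g k * star (dft ξ n g k) =
      ∑ p ∈ Finset.range n, g p * star (g p) := by
  rcases Nat.eq_zero_or_pos n with rfl | hn
  · simp
  have hterm : ∀ k, dft ξ n g k * star (dft ξ n g k) =
      (n : ℂ)⁻¹ • ∑ p ∈ Finset.range n, ∑ q ∈ Finset.range n,
        (ξ ^ (k * p) * star (ξ ^ (k * q))) • (g p * star (g q)) := by
    intro k
    rw [dft, star_smul, smul_mul_smul_comm, sqrt_inv_mul_star, star_sum, Finset.sum_mul_sum]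
    congr 1
    refine Finset.sum_congr rfl fun p _ => Finset.sum_congr rfl fun q _ => ?_
    rw [star_smul, smul_mul_smul_comm]
  simp only [hterm]
  rw [← Finset.smul_sum, Finset.sum_comm, Finset.smul_sum]
  refine Finset.sum_congr rfl fun p hp => ?_
  rw [Finset.sum_comm, Finset.sum_eq_single_of_mem p hp]
  · rw [← Finset.sum_smul, sum_pow_mul_star_pow hξ (Finset.mem_range.1 hp) (Finset.mem_range.1 hp),
      if_pos rfl, smul_smul, inv_mul_cancel₀ (by exact_mod_cast hn.ne'), one_smul]
  · intro q hq hqp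
    rw [← Finset.sum_smul, sum_pow_mul_star_pow hξ (Finset.mem_range.1 hp) (Finset.mem_range.1 hq),
      if_neg hqp.symm, zero_smul]

/-- A unitary scalar matrix preserves a Gram matrix of the form `e` times the identity. -/
lemma IsGramDiagonal.dft {ξ : ℂ} {n : ℕ} (hξ : IsPrimitiveRoot ξ n) {e : D} {g : ℕ → D}
    (hg : IsGramDiagonal e (Finset.range n : Set ℕ) g) :
    IsGramDiagonal e (Finset.range n : Set ℕ) (dft ξ n g) := by
  have key : ∀ k ∈ Finset.range n, ∀ l ∈ Finset.range n,
      star (RokhlinTower.dft ξ n g k) * RokhlinTower.dft ξ n g l = if l = k then e else 0 := by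
    intro k hk l hl
    have hn : (n : ℂ) ≠ 0 := by
      have := Finset.mem_range.1 hk
      exact_mod_cast (by omega : n ≠ 0)
    rw [RokhlinTower.dft, RokhlinTower.dft, star_smul, smul_mul_smul_comm,
      mul_comm (star _), sqrt_inv_mul_star, star_sum, Finset.sum_mul_sum]
    have : ∀ p ∈ Finset.range n, ∑ q ∈ Finset.range n,
        star (ξ ^ (k * p) • g p) * (ξ ^ (l * q) • g q) =
        (ξ ^ (p * l) * star (ξ ^ (p * k))) • e := by
      intro p hp
      rw [Finset.sum_eq_single_of_mem p hp]
      · rw [star_smul, smul_mul_smul_comm, hg.1 p hp, mul_comm (star _), mul_comm l, mul_comm k]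
      · intro q hq hqp
        rw [star_smul, smul_mul_smul_comm, hg.2 p hp q hq hqp.symm, smul_zero]
    rw [Finset.sum_congr rfl this, ← Finset.sum_smul,
      sum_pow_mul_star_pow hξ (Finset.mem_range.1 hl) (Finset.mem_range.1 hk)]
    split_ifs
    · rw [smul_smul, inv_mul_cancel₀ hn, one_smul]
    · simp
  refine ⟨fun i hi => ?_, fun i hi j hj hij => ?_⟩
  · rw [key i hi i hi, if_pos rfl]
  · rw [key i hi j hj, if_neg hij.symm]

/-- If `α` shifts a sequence that nearly closes up after `n` steps, its Fourier transform consists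
of approximate eigenvectors of `α`. -/
lemma map_dft_inv_sub {ζ : ℂ} {n : ℕ} (hn : n ≠ 0) (hζ : ζ ^ n = 1) (α : D ≃⋆ₐ[ℂ] D) {g : ℕ → D}
    (hg : ∀ i, α (g i) = g (i + 1)) (p : ℕ) :
    α (dft ζ⁻¹ n g p) - ζ ^ p • dft ζ⁻¹ n g p =
      ((√(n : ℝ) : ℝ) : ℂ)⁻¹ • ζ ^ p • (g n - g 0) := by
  have hζ0 : ζ ≠ 0 := by
    rintro rfl
    simp [hn] at hζ
  -- The difference telescopes: only the gap `g n - g 0` survives, and the normalisation leaves it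
  -- with the factor `1 / √n`.
  have h := Finset.sum_range_sub (fun i => (ζ ^ p * ζ⁻¹ ^ (p * i)) • g i) n
  have h1 : ∀ i, ζ ^ p * ζ⁻¹ ^ (p * (i + 1)) = ζ⁻¹ ^ (p * i) := by
    intro i
    rw [mul_add, mul_one, pow_add, inv_pow ζ p]
    field_simp
  have h2 : ζ⁻¹ ^ (p * n) = 1 := by
    rw [mul_comm, pow_mul, inv_pow, hζ]
    simp
  simp only [h1, h2, mul_zero, pow_zero, mul_one] at h
  rw [map_dft, dft, dft, smul_comm (ζ ^ p), ← smul_sub, smul_sub (ζ ^ p), ← h,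
    Finset.sum_sub_distrib, Finset.smul_sum]
  simp only [hg, smul_smul]

end Dft

/-! ### From approximate eigenvectors to approximate towers -/

section Towers

variable {D : Type*} [CStarAlgebra D] [PartialOrder D] [StarOrderedRing D]

/-- Approximate eigenvectors for the `n`-th roots of unity yield an approximate tower of
height `n`. -/
lemma norm_map_sum_dft_sub_le {ξ : ℂ} {n : ℕ} (hξ : IsPrimitiveRoot ξ n) (α : D ≃⋆ₐ[ℂ] D) {e : D}
    (he : e ≤ 1) {x : ℕ → D} (hx : IsGramDiagonal e (Finset.range n : Set ℕ) x) {δ : ℝ}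
    (hδ : 0 ≤ δ) (hαx : ‖∑ p ∈ Finset.range n, (α (x p) - ξ ^ p • x p) *
      star (α (x p) - ξ ^ p • x p)‖ ≤ δ ^ 2) {T : Finset ℕ} (hT : T ⊆ Finset.range n) :
    ‖α (∑ k ∈ T, dft ξ n x k * star (dft ξ n x k)) -
      ∑ k ∈ T, dft ξ n x (k + 1) * star (dft ξ n x (k + 1))‖ ≤ 2 * δ + δ ^ 2 := by
  have h := norm_sum_mul_star_self_sub_le T (fun k => α (dft ξ n x k))
    (fun k => dft ξ n x (k + 1)) hδ ?_ ?_
  · simpa only [map_sum, map_mul, map_star] using h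
  · refine (norm_sum_mul_star_self_mono hT _).trans ?_
    have hper : Function.Periodic (fun k => dft ξ n x k * star (dft ξ n x k)) n := fun k => by
      simp only [dft_periodic hξ.pow_eq_one x k]
    have := sum_range_succ_eq_of_periodic hper
    rw [this]
    exact (hx.dft hξ).norm_sum_le_one he
  · refine (norm_sum_mul_star_self_mono hT _).trans ?_
    -- The error of the shift is itself the transform of the eigenvector errors, so Parseval gives
    -- it the same row norm.
    have : ∀ k, α (dft ξ n x k) - dft ξ n x (k + 1) =
        dft ξ n (fun p => α (x p) - ξ ^ p • x p) k := by
      intro k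
      rw [dft_sub, map_dft, dft_add_one]
    simp only [this]
    rw [sum_dft_mul_star hξ]
    exact hαx

/-- A column is a subfamily of the row, so the bound is independent of the number `K` of folded
terms. -/
lemma norm_map_columnSum_sub_le {m K : ℕ} {ξ : ℂ} (hξ : IsPrimitiveRoot ξ (m * K))
    (α : D ≃⋆ₐ[ℂ] D) {e : D} (he : e ≤ 1) {x : ℕ → D}
    (hx : IsGramDiagonal e (Finset.range (m * K) : Set ℕ) x) {δ : ℝ}
    (hδ : 0 ≤ δ) (hαx : ‖∑ p ∈ Finset.range (m * K), (α (x p) - ξ ^ p • x p) *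
      star (α (x p) - ξ ^ p • x p)‖ ≤ δ ^ 2) {j : ℕ} (hj : j < m) :
    ‖α (columnSum m K (fun k => dft ξ (m * K) x k * star (dft ξ (m * K) x k)) j) -
      columnSum m K (fun k => dft ξ (m * K) x k * star (dft ξ (m * K) x k)) (j + 1)‖ ≤
        2 * δ + δ ^ 2 := by
  classical
  have hT : (Finset.range K).image (fun r => j + m * r) ⊆ Finset.range (m * K) := by
    intro k hk
    obtain ⟨r, hr, rfl⟩ := Finset.mem_image.1 hk
    have := Finset.mem_range.1 hr
    rw [Finset.mem_range]
    calc j + m * r < m + m * r := by omega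
      _ = m * (r + 1) := by ring
      _ ≤ m * K := Nat.mul_le_mul_left m this
  have h := norm_map_sum_dft_sub_le hξ α he hx hδ hαx hT
  have hinj : Set.InjOn (fun r => j + m * r) (Finset.range K : Set ℕ) := by
    intro r _ r' _ h
    exact Nat.eq_of_mul_eq_mul_left (by omega : 0 < m) (Nat.add_left_cancel h)
  rw [Finset.sum_image hinj, Finset.sum_image hinj] at h
  simpa only [columnSum, add_right_comm] using h

end Towers

set_option linter.unusedSectionVars false

/-! ### Iterates of the element supplied by property (SI) -/

section Cycle

variable {D : Type*} [CStarAlgebra D] [PartialOrder D] [StarOrderedRing D]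

/-- A cyclic tower `φ 0, …, φ (n - 1)` in `S` of mutually orthogonal positive elements permuted by
`α`, together with a subordinate element `s` such that `s* s` is the defect `1 - ∑ φ k`. -/
structure DefectTower (S : StarSubalgebra ℂ D) (α : D ≃⋆ₐ[ℂ] D) (n : ℕ) (φ : ℕ → D) (s : D) :
    Prop where
  periodic : Function.Periodic φ n
  mem : ∀ k, φ k ∈ S
  nonneg : ∀ k, 0 ≤ φ k
  map : ∀ k, α (φ k) = φ (k + 1)
  orthogonal : ∀ k l, ¬ k ≡ l [MOD n] → φ k * φ l = 0
  mem_defect : s ∈ S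
  mul_defect : φ 0 * s = s
  star_mul_defect : star s * s = 1 - ∑ k ∈ Finset.range n, φ k

namespace DefectTower

variable {S : StarSubalgebra ℂ D} {α : D ≃⋆ₐ[ℂ] D} {n : ℕ} {φ : ℕ → D} {s : D}

lemma defect_nonneg (h : DefectTower S α n φ s) : 0 ≤ 1 - ∑ k ∈ Finset.range n, φ k :=
  h.star_mul_defect ▸ star_mul_self_nonneg s

lemma defect_le_one (h : DefectTower S α n φ s) : 1 - ∑ k ∈ Finset.range n, φ k ≤ 1 :=
  sub_le_self _ (Finset.sum_nonneg fun k _ => h.nonneg k)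

lemma map_defect (h : DefectTower S α n φ s) :
    α (1 - ∑ k ∈ Finset.range n, φ k) = 1 - ∑ k ∈ Finset.range n, φ k := by
  simp only [map_sub, map_one, map_sum, h.map, sum_range_succ_eq_of_periodic h.periodic]

lemma mul_iterate (h : DefectTower S α n φ s) (k : ℕ) : φ k * α^[k] s = α^[k] s := by
  induction k with
  | zero => exact h.mul_defect
  | succ k ih => rw [Function.iterate_succ_apply', ← h.map, ← map_mul, ih]

lemma mul_iterate_eq_zero (h : DefectTower S α n φ s) {k l : ℕ} (hkl : ¬ l ≡ k [MOD n]) :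
    φ l * α^[k] s = 0 := by
  rw [← h.mul_iterate k, ← mul_assoc, h.orthogonal l k hkl, zero_mul]

lemma star_iterate_mul_iterate (h : DefectTower S α n φ s) (k : ℕ) :
    star (α^[k] s) * α^[k] s = 1 - ∑ k ∈ Finset.range n, φ k := by
  induction k with
  | zero => exact h.star_mul_defect
  | succ k ih => rw [Function.iterate_succ_apply', ← map_star, ← map_mul, ih, h.map_defect]

lemma norm_iterate_le (h : DefectTower S α n φ s) (k : ℕ) : ‖α^[k] s‖ ≤ 1 := by
  have h1 := CStarRing.norm_star_mul_self (x := α^[k] s)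
  have h2 := (CStarAlgebra.norm_le_one_iff_of_nonneg _ h.defect_nonneg).2 h.defect_le_one
  rw [← h.star_iterate_mul_iterate k, h1] at h2
  nlinarith [norm_nonneg (α^[k] s)]

lemma star_iterate_mul_iterate_eq_zero (h : DefectTower S α n φ s) {k l : ℕ}
    (hkl : ¬ k ≡ l [MOD n]) : star (α^[k] s) * α^[l] s = 0 := by
  rw [← h.mul_iterate k, star_mul, (IsSelfAdjoint.of_nonneg (h.nonneg k)).star_eq, mul_assoc,
    h.mul_iterate_eq_zero hkl, mul_zero]

lemma iterate_mem (h : DefectTower S α n φ s) (hS : ∀ x ∈ S, α x ∈ S) (k : ℕ) : α^[k] s ∈ S := by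
  induction k with
  | zero => exact h.mem_defect
  | succ k ih => rw [Function.iterate_succ_apply']; exact hS _ ih

lemma columnSum_mul_iterate_eq_zero (h : DefectTower S α n φ s) {m : ℕ} (hm : m ∣ n) (K : ℕ)
    {j k : ℕ} (hjk : ¬ j ≡ k [MOD m]) : columnSum m K φ j * α^[k] s = 0 := by
  rw [columnSum, Finset.sum_mul]
  refine Finset.sum_eq_zero fun r _ => h.mul_iterate_eq_zero fun hr => hjk ?_
  have := hr.of_dvd hm
  simpa [Nat.ModEq] using this

/-- Only the rung congruent to `k` acts nontrivially on `α^[k] s`, and it acts as a unit. Hence the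
defect annihilates every iterate. -/
lemma sum_mul_iterate (h : DefectTower S α n φ s) (hn : n ≠ 0) (k : ℕ) :
    (∑ l ∈ Finset.range n, φ l) * α^[k] s = α^[k] s := by
  rw [Finset.sum_mul, Finset.sum_eq_single_of_mem (k % n)
    (Finset.mem_range.2 (Nat.mod_lt _ (Nat.pos_of_ne_zero hn))), h.periodic.map_mod_nat,
    h.mul_iterate]
  intro l hl hlk
  refine h.mul_iterate_eq_zero fun hmod => hlk ?_
  rw [← hmod, Nat.mod_eq_of_lt (Finset.mem_range.1 hl)]

lemma columnSum_mul_iterate {m K : ℕ} (h : DefectTower S α (m * K) φ s) (hn : m * K ≠ 0) {j k : ℕ}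
    (hjk : j ≡ k [MOD m]) : columnSum m K φ j * α^[k] s = α^[k] s := by
  have hm : 0 < m := Nat.pos_of_ne_zero (left_ne_zero_of_mul hn)
  have h1 := h.sum_mul_iterate hn k
  rw [← sum_columnSum, Finset.sum_mul, Finset.sum_eq_single_of_mem (k % m)
    (Finset.mem_range.2 (Nat.mod_lt _ hm))] at h1
  · rw [← (columnSum_periodic h.periodic).map_mod_nat, hjk]
    exact h1
  · intro l hl hlk
    refine h.columnSum_mul_iterate_eq_zero (Dvd.intro _ rfl) K fun hmod => hlk ?_
    rw [← hmod, Nat.mod_eq_of_lt (Finset.mem_range.1 hl)]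

lemma columnSum_nonneg (h : DefectTower S α n φ s) (m K j : ℕ) : 0 ≤ columnSum m K φ j :=
  Finset.sum_nonneg fun _ _ => h.nonneg _

lemma columnSum_le_one {m K : ℕ} (h : DefectTower S α (m * K) φ s) {j : ℕ} (hj : j < m) :
    columnSum m K φ j ≤ 1 := by
  refine le_trans ?_ (sub_nonneg.1 h.defect_nonneg)
  rw [← sum_columnSum]
  exact Finset.single_le_sum (f := columnSum m K φ) (fun i _ => h.columnSum_nonneg m K i)
    (Finset.mem_range.2 hj)

lemma columnSum_mul_columnSum (h : DefectTower S α n φ s) {m : ℕ} (hm : m ∣ n) (K : ℕ)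
    {i j : ℕ} (hij : ¬ i ≡ j [MOD m]) : columnSum m K φ i * columnSum m K φ j = 0 := by
  rw [columnSum, columnSum, Finset.sum_mul_sum]
  refine Finset.sum_eq_zero fun r _ => Finset.sum_eq_zero fun r' _ => h.orthogonal _ _ fun hr => hij ?_
  have := hr.of_dvd hm
  simpa [Nat.ModEq] using this

lemma map_columnSum (h : DefectTower S α n φ s) (m K j : ℕ) :
    α (columnSum m K φ j) = columnSum m K φ (j + 1) := by
  simp only [columnSum, map_sum, h.map, add_right_comm]

end DefectTower

/-- Averages of the iterates `α^[k] s` along arithmetic progressions. -/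
noncomputable def averagedIterate (α : D ≃⋆ₐ[ℂ] D) (s : D) (N L i : ℕ) : D :=
  ((√(L : ℝ) : ℝ) : ℂ)⁻¹ • columnSum N L (fun k => α^[k] s) i

namespace DefectTower

variable {S : StarSubalgebra ℂ D} {α : D ≃⋆ₐ[ℂ] D} {N L : ℕ} {φ : ℕ → D} {s : D}

lemma map_averagedIterate (α : D ≃⋆ₐ[ℂ] D) (s : D) (N L i : ℕ) :
    α (averagedIterate α s N L i) = averagedIterate α s N L (i + 1) := by
  simp only [averagedIterate, columnSum, map_smul, map_sum, ← Function.iterate_succ_apply' α,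
    Nat.succ_eq_add_one, add_right_comm]

lemma averagedIterate_mem {n : ℕ} (h : DefectTower S α n φ s) (hS : ∀ x ∈ S, α x ∈ S) (N L i : ℕ) :
    averagedIterate α s N L i ∈ S :=
  S.smul_mem (sum_mem fun _ _ => h.iterate_mem hS _) _

/-- The sum over the progression telescopes to its two end terms, each a contraction; the weight `1
/ √L` makes the gap small uniformly in `N`. -/
lemma norm_averagedIterate_sub_le {n : ℕ} (h : DefectTower S α n φ s) (N L : ℕ) :
    ‖averagedIterate α s N L N - averagedIterate α s N L 0‖ ≤ 2 / √(L : ℝ) := by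
  have h1 := Finset.sum_range_sub (fun r => α^[N * r] s) L
  rw [Finset.sum_sub_distrib] at h1
  have h2 : averagedIterate α s N L N - averagedIterate α s N L 0 =
      ((√(L : ℝ) : ℝ) : ℂ)⁻¹ • (α^[N * L] s - α^[N * 0] s) := by
    rw [← h1, smul_sub]
    simp only [averagedIterate, columnSum, mul_add, mul_one, zero_add, add_comm N]
  rw [h2, norm_smul, norm_inv, Complex.norm_real, Real.norm_of_nonneg (Real.sqrt_nonneg _),
    div_eq_inv_mul]
  refine mul_le_mul_of_nonneg_left ?_ (by positivity)
  refine (norm_sub_le _ _).trans ?_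
  linarith [h.norm_iterate_le (N * L), h.norm_iterate_le (N * 0)]

lemma add_mul_lt {i r : ℕ} (hi : i < N) (hr : r < L) : i + N * r < N * L := by
  calc i + N * r < N + N * r := by omega
    _ = N * (r + 1) := by ring
    _ ≤ N * L := Nat.mul_le_mul_left N hr

/-- The exponents `i + N * r` are distinct below `N * L`, so all iterates involved are mutually
orthogonal; the `L` diagonal terms each contribute `e` with weight `1 / L`. -/
lemma isGramDiagonal_averagedIterate (h : DefectTower S α (N * L) φ s) (hL : L ≠ 0) :
    IsGramDiagonal (1 - ∑ k ∈ Finset.range (N * L), φ k) (Finset.range N : Set ℕ)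
      (averagedIterate α s N L) := by
  have key : ∀ i < N, ∀ j < N, ∀ r < L, ∀ r' < L, (i, r) ≠ (j, r') →
      star (α^[i + N * r] s) * α^[j + N * r'] s = 0 := by
    intro i hi j hj r hr r' hr' hne
    refine h.star_iterate_mul_iterate_eq_zero fun hmod => hne ?_
    have h1 := Nat.ModEq.eq_of_lt_of_lt hmod (add_mul_lt hi hr) (add_mul_lt hj hr')
    have h2 := congrArg (· % N) h1
    simp only [Nat.add_mul_mod_self_left, Nat.mod_eq_of_lt hi, Nat.mod_eq_of_lt hj] at h2
    subst h2
    rw [Nat.eq_of_mul_eq_mul_left (by omega : 0 < N) (Nat.add_left_cancel h1)]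
  have hcoe : ∀ i, i ∈ (Finset.range N : Set ℕ) → i < N := fun i hi => by simpa using hi
  refine ⟨fun i hi => ?_, fun i hi j hj hij => ?_⟩
  · rw [averagedIterate, star_smul, smul_mul_smul_comm, mul_comm (star _), sqrt_inv_mul_star,
      columnSum, star_sum, Finset.sum_mul_sum]
    have : ∀ r ∈ Finset.range L, ∑ r' ∈ Finset.range L,
        star (α^[i + N * r] s) * α^[i + N * r'] s = 1 - ∑ k ∈ Finset.range (N * L), φ k := by
      intro r hr
      rw [Finset.sum_eq_single_of_mem r hr, h.star_iterate_mul_iterate]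
      intro r' hr' hne
      exact key i (hcoe i hi) i (hcoe i hi) r (Finset.mem_range.1 hr) r' (Finset.mem_range.1 hr')
        (by simpa using hne.symm)
    rw [Finset.sum_congr rfl this, Finset.sum_const, Finset.card_range, ← Nat.cast_smul_eq_nsmul ℂ,
      smul_smul, inv_mul_cancel₀ (by exact_mod_cast hL), one_smul]
  · rw [averagedIterate, averagedIterate, star_smul, smul_mul_smul_comm, columnSum, columnSum,
      star_sum, Finset.sum_mul_sum]
    rw [Finset.sum_eq_zero, smul_zero]
    intro r hr
    refine Finset.sum_eq_zero fun r' hr' => ?_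
    exact key i (hcoe i hi) j (hcoe j hj) r (Finset.mem_range.1 hr) r' (Finset.mem_range.1 hr')
        (by simp [hij])

lemma columnSum_mul_averagedIterate {m K : ℕ} (h : DefectTower S α (m * K) φ s) (hn : m * K ≠ 0)
    (hN : m ∣ N) {i j : ℕ} (hij : i ≡ j [MOD m]) :
    columnSum m K φ i * averagedIterate α s N L j = averagedIterate α s N L j := by
  rw [averagedIterate, mul_smul_comm, columnSum.eq_1 N, Finset.mul_sum]
  congr 1
  refine Finset.sum_congr rfl fun r _ => h.columnSum_mul_iterate hn ?_
  obtain ⟨c, rfl⟩ := hN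
  rw [mul_assoc]
  simpa [Nat.ModEq] using hij

lemma columnSum_mul_averagedIterate_eq_zero {m K : ℕ} (h : DefectTower S α (m * K) φ s)
    (hN : m ∣ N) {i j : ℕ} (hij : ¬ i ≡ j [MOD m]) :
    columnSum m K φ i * averagedIterate α s N L j = 0 := by
  rw [averagedIterate, mul_smul_comm, columnSum.eq_1 N, Finset.mul_sum, Finset.sum_eq_zero,
    smul_zero]
  intro r _
  refine h.columnSum_mul_iterate_eq_zero (Dvd.intro _ rfl) K fun hmod => hij ?_
  obtain ⟨c, rfl⟩ := hN
  rw [mul_assoc] at hmod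
  simpa [Nat.ModEq] using hmod

lemma defect_mul_averagedIterate {n : ℕ} (h : DefectTower S α n φ s) (hn : n ≠ 0) (j : ℕ) :
    (1 - ∑ k ∈ Finset.range n, φ k) * averagedIterate α s N L j = 0 := by
  rw [averagedIterate, mul_smul_comm, columnSum, Finset.mul_sum, Finset.sum_eq_zero, smul_zero]
  intro r _
  rw [sub_mul, h.sum_mul_iterate hn, one_mul, sub_self]

end DefectTower

end Cycle

/-! ### Enumerating the remaining roots of unity -/

section Enumeration

/-- The complement of a set of `m` elements of `{0, …, N - 1}` is enumerated by `{0, …, n - 1}`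
with displacement at most `m`. -/
lemma exists_enumeration {N m n : ℕ} {Q : Finset ℕ} (hQ : Q ⊆ Finset.range N) (hm : Q.card = m)
    (hn : n + m = N) :
    ∃ σ : ℕ → ℕ, (∀ p < n, σ p ∈ Finset.range N \ Q) ∧ Set.InjOn σ (Finset.range n : Set ℕ) ∧
      (Finset.range n).image σ = Finset.range N \ Q ∧ ∀ p < n, p ≤ σ p ∧ σ p ≤ p + m := by
  classical
  set T := Finset.range N \ Q with hT
  have hc : T.card = n := by
    rw [hT, Finset.card_sdiff_of_subset hQ, Finset.card_range]
    omega
  let f := T.orderEmbOfFin hc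
  let σ : ℕ → ℕ := fun p => if h : p < n then f ⟨p, h⟩ else 0
  have hσ : ∀ p (h : p < n), σ p = f ⟨p, h⟩ := fun p h => dif_pos h
  have hmem : ∀ p < n, σ p ∈ T := fun p h => by
    rw [hσ p h]; exact T.orderEmbOfFin_mem hc _
  have hinj : Set.InjOn σ (Finset.range n : Set ℕ) := by
    intro p hp q hq hpq
    have hp' : p < n := by simpa using hp
    have hq' : q < n := by simpa using hq
    rw [hσ p hp', hσ q hq'] at hpq
    simpa using f.injective hpq
  refine ⟨σ, hmem, hinj, ?_, ?_⟩
  · refine Finset.eq_of_subset_of_card_le ?_ ?_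
    · intro t ht
      obtain ⟨p, hp, rfl⟩ := Finset.mem_image.1 ht
      exact hmem p (Finset.mem_range.1 hp)
    · rw [Finset.card_image_of_injOn hinj, Finset.card_range, hc]
  · intro p hp
    -- With the increasing enumeration, exactly `p` elements of the complement lie below `σ p`.
    -- Hence `σ p - p` counts the elements of `Q` below `σ p`, of which there are at most `m`.
    have h1 : T.filter (· < σ p) = (Finset.univ.filter (· < (⟨p, hp⟩ : Fin n))).map f.toEmbedding := by
      rw [hσ p hp]
      ext t
      simp only [Finset.mem_filter, Finset.mem_map, Finset.mem_univ, true_and]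
      constructor
      · rintro ⟨ht, hlt⟩
        rw [← Finset.image_orderEmbOfFin_univ T hc, Finset.mem_image] at ht
        obtain ⟨i, -, rfl⟩ := ht
        exact ⟨i, f.lt_iff_lt.1 hlt, rfl⟩
      · rintro ⟨i, hi, rfl⟩
        exact ⟨T.orderEmbOfFin_mem hc _, f.lt_iff_lt.2 hi⟩
    have h2 : (T.filter (· < σ p)).card = p := by
      rw [h1, Finset.card_map, Finset.filter_gt_eq_Iio, Fin.card_Iio]
    have h3 : σ p < N := Finset.mem_range.1 (Finset.mem_sdiff.1 (hmem p hp)).1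
    have h4 : T.filter (· < σ p) = Finset.range (σ p) \ Q := by
      ext t
      simp only [hT, Finset.mem_filter, Finset.mem_sdiff, Finset.mem_range]
      constructor
      · rintro ⟨⟨_, h⟩, h'⟩; exact ⟨h', h⟩
      · rintro ⟨h, h'⟩; exact ⟨⟨h.trans h3, h'⟩, h⟩
    rw [h4] at h2
    have h5 := Finset.card_le_card (Finset.sdiff_subset (s := Finset.range (σ p)) (t := Q))
    have h6 := Finset.le_card_sdiff Q (Finset.range (σ p))
    rw [Finset.card_range] at h5 h6
    omega

end Enumeration

/-! ### Eigenvectors and the first tower from a defect tower -/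

section ApproximateTowers

variable {D : Type*} [CStarAlgebra D] [PartialOrder D] [StarOrderedRing D]

lemma norm_mul_star_self_sub_le {D : Type*} [CStarAlgebra D] {x y : D} (hx : ‖x‖ ≤ 1) (hy : ‖y‖ ≤ 1) :
    ‖x * star x - y * star y‖ ≤ 2 * ‖x - y‖ := by
  have : x * star x - y * star y = (x - y) * star x + y * star (x - y) := by
    rw [star_sub]; noncomm_ring
  rw [this]
  refine (norm_add_le _ _).trans ?_
  have h1 := norm_mul_le (x - y) (star x)
  have h2 := norm_mul_le y (star (x - y))
  rw [norm_star] at h1 h2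
  nlinarith [norm_nonneg (x - y), norm_nonneg x, norm_nonneg y]

lemma IsGramDiagonal.norm_le_one {ι : Type*} {e : D} {T : Set ι} {x : ι → D} (he : e ≤ 1)
    (hx : IsGramDiagonal e T x) {i : ι} (hi : i ∈ T) : ‖x i‖ ≤ 1 := by
  have h0 : 0 ≤ e := hx.1 i hi ▸ star_mul_self_nonneg (x i)
  have h1 := (CStarAlgebra.norm_le_one_iff_of_nonneg e h0).2 he
  rw [← hx.1 i hi, CStarRing.norm_star_mul_self] at h1
  nlinarith [norm_nonneg (x i)]

/-- From a defect tower of height `N * L` one gets approximate eigenvectors of `α` for all `N`-th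
roots of unity, and an approximate tower of height `m` that complements them and the defect. -/
lemma DefectTower.exists_eigenvectors {S : StarSubalgebra ℂ D} {α : D ≃⋆ₐ[ℂ] D} {N L m : ℕ}
    {φ : ℕ → D} {s : D} (h : DefectTower S α (N * L) φ s) (hS : ∀ x ∈ S, α x ∈ S)
    (hN : N ≠ 0) (hL : L ≠ 0) (hmN : m ∣ N) {ζ : ℂ} (hζ : IsPrimitiveRoot ζ N) {κ : ℝ}
    (hκ : 2 / √(L : ℝ) ≤ κ) :
    ∃ x a : ℕ → D,
      IsGramDiagonal (1 - ∑ k ∈ Finset.range (N * L), φ k) (Finset.range N : Set ℕ) x ∧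
      (∀ p, (1 - ∑ k ∈ Finset.range (N * L), φ k) * x p = 0) ∧
      (∀ p, x p ∈ S) ∧
      (∀ p, ‖α (x p) - ζ ^ p • x p‖ ≤ κ / √(N : ℝ)) ∧
      Function.Periodic a m ∧ (∀ j, a j ∈ S) ∧ (∀ j < m, 0 ≤ a j) ∧
      (∀ i < m, ∀ j < m, i ≠ j → a i * a j = 0) ∧
      (∀ j < m, ‖α (a j) - a (j + 1)‖ ≤ 2 * κ) ∧
      ∑ j ∈ Finset.range m, a j = ∑ k ∈ Finset.range (N * L), φ k -
        ∑ p ∈ Finset.range N, x p * star (x p) := by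
  have hκ0 : 0 ≤ κ := le_trans (by positivity) hκ
  have hm : 0 < m := Nat.pos_of_ne_zero fun h => hN (Nat.eq_zero_of_zero_dvd (h ▸ hmN))
  have hn : N * L ≠ 0 := mul_ne_zero hN hL
  set e := 1 - ∑ k ∈ Finset.range (N * L), φ k with he
  set g := averagedIterate α s N L with hg
  have hgram : IsGramDiagonal e (Finset.range N : Set ℕ) g := h.isGramDiagonal_averagedIterate hL
  have hgS : ∀ i, g i ∈ S := h.averagedIterate_mem hS N L
  have hgα : ∀ i, α (g i) = g (i + 1) := map_averagedIterate α s N L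
  have heg : ∀ i, e * g i = 0 := h.defect_mul_averagedIterate hn
  have hdist : ‖g N - g 0‖ ≤ κ := (h.norm_averagedIterate_sub_le N L).trans hκ
  have hζinv : IsPrimitiveRoot ζ⁻¹ N := hζ.inv
  have hsum := sum_dft_mul_star hζinv g
  obtain ⟨K, hK⟩ : ∃ K, N * L = m * K := hmN.mul_right L
  have h' : DefectTower S α (m * K) φ s := hK ▸ h
  have hn' : m * K ≠ 0 := hK ▸ hn
  set G := columnSum m K φ with hG
  have hGper : Function.Periodic G m := columnSum_periodic h'.periodic
  have hG0 : ∀ j, 0 ≤ G j := h.columnSum_nonneg m K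
  have hGsa : ∀ j, star (G j) = G j := fun j => (IsSelfAdjoint.of_nonneg (hG0 j)).star_eq
  have hGS : ∀ j, G j ∈ S := fun j => sum_mem fun _ _ => h.mem _
  set X := ∑ p ∈ Finset.range N, g p * star (g p) with hX
  have hXS : X ∈ S := sum_mem fun p _ => mul_mem (hgS p) (star_mem (hgS p))
  have hX1 : X ≤ 1 := hgram.sum_le_one h.defect_le_one
  have hαX : ‖α X - X‖ ≤ 2 * κ := by
    -- Applying `α` shifts the summands of `X`, so only the two boundary terms remain.
    have h1 : α X - X = g N * star (g N) - g 0 * star (g 0) := by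
      rw [← Finset.sum_range_sub (fun p => g p * star (g p)) N, Finset.sum_sub_distrib, hX, map_sum]
      simp only [map_mul, map_star, hgα]
    have h2 : ‖g 0‖ ≤ 1 := hgram.norm_le_one h.defect_le_one (by simpa using Nat.pos_of_ne_zero hN)
    have h3 : ‖g N‖ ≤ 1 := by
      have h4 : g N = α (g (N - 1)) := by rw [hgα, Nat.sub_add_cancel (Nat.pos_of_ne_zero hN)]
      rw [h4]
      refine (NonUnitalStarAlgHom.norm_apply_le α _).trans
        (hgram.norm_le_one h.defect_le_one (by simp; omega))
    rw [h1]
    exact (norm_mul_star_self_sub_le h3 h2).trans (by linarith)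
  -- The inverse root makes the `p`-th transform an eigenvector for `ζ ^ p`. Compressing `X` by each
  -- `G j` keeps the columns orthogonal and positive, since `G j * X * G j ≤ G j * G j ≤ G j`.
  refine ⟨dft ζ⁻¹ N g, fun j => G j - G j * X * G j, hgram.dft hζinv, ?_, ?_, ?_, ?_, ?_, ?_, ?_,
    ?_, ?_⟩
  · intro p
    rw [dft, mul_smul_comm, Finset.mul_sum, Finset.sum_eq_zero, smul_zero]
    intro i _
    rw [mul_smul_comm, heg, smul_zero]
  · exact dft_mem S _ fun p _ => hgS p
  · intro p
    rw [map_dft_inv_sub hN hζ.pow_eq_one α hgα, norm_smul, norm_smul, norm_pow,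
      hζ.norm'_eq_one hN, one_pow, one_mul, norm_inv, Complex.norm_real,
      Real.norm_of_nonneg (Real.sqrt_nonneg _), div_eq_inv_mul]
    exact mul_le_mul_of_nonneg_left hdist (by positivity)
  · intro j
    simp only [hGper j]
  · intro j
    exact sub_mem (hGS j) (mul_mem (mul_mem (hGS j) hXS) (hGS j))
  · intro j hj
    have h1 := star_right_conjugate_le_conjugate hX1 (G j)
    rw [hGsa, mul_one] at h1
    exact sub_nonneg.2 (h1.trans (mul_self_le_of_le_one (hG0 j) (h'.columnSum_le_one hj)))
  · intro i hi j hj hij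
    have hGG : G i * G j = 0 := h'.columnSum_mul_columnSum (Dvd.intro _ rfl) K fun hmod =>
      hij (Nat.ModEq.eq_of_lt_of_lt hmod hi hj)
    calc _ = (1 - G i * X) * (G i * G j) * (1 - X * G j) := by noncomm_ring
      _ = 0 := by rw [hGG, mul_zero, zero_mul]
  · intro j hj
    have h1 : α (G j - G j * X * G j) - (G (j + 1) - G (j + 1) * X * G (j + 1)) =
        -(G (j + 1) * (α X - X) * G (j + 1)) := by
      have : α (G j) = G (j + 1) := h.map_columnSum m K j
      rw [map_sub, map_mul, map_mul, this]
      noncomm_ring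
    have h2 : ‖G (j + 1)‖ ≤ 1 := by
      rw [← hGper.map_mod_nat, CStarAlgebra.norm_le_one_iff_of_nonneg _ (hG0 _)]
      exact h'.columnSum_le_one (Nat.mod_lt _ hm)
    rw [h1, norm_neg]
    refine (norm_mul_le _ _).trans ?_
    have h3 := norm_mul_le (G (j + 1)) (α X - X)
    calc _ ≤ ‖G (j + 1)‖ * ‖α X - X‖ * ‖G (j + 1)‖ := by gcongr
      _ ≤ 1 * (2 * κ) * 1 := by gcongr
      _ = 2 * κ := by ring
  · rw [Finset.sum_sub_distrib, hsum, hG, sum_columnSum, ← hK, ← hG]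
    congr 1
    -- `G j` fixes `g p` if `p ≡ j` modulo `m` and kills it otherwise, so the compressions split `X`
    -- without loss.
    have h1 : ∀ j ∈ Finset.range m, G j * X * G j =
        ∑ p ∈ Finset.range N, if p % m = j then g p * star (g p) else 0 := by
      intro j hj
      rw [hX, Finset.mul_sum, Finset.sum_mul]
      refine Finset.sum_congr rfl fun p _ => ?_
      have h2 : G j * (g p * star (g p)) * G j = (G j * g p) * star (G j * g p) := by
        rw [star_mul, hGsa]; noncomm_ring
      rw [h2]
      split_ifs with hp
      · rw [hG, h'.columnSum_mul_averagedIterate hn' hmN]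
        rw [Nat.ModEq, hp, Nat.mod_eq_of_lt (Finset.mem_range.1 hj)]
      · rw [hG, h'.columnSum_mul_averagedIterate_eq_zero hmN, zero_mul]
        rw [Nat.ModEq, Nat.mod_eq_of_lt (Finset.mem_range.1 hj)]
        exact fun h => hp h.symm
    rw [Finset.sum_congr rfl h1, Finset.sum_comm]
    refine Finset.sum_congr rfl fun p _ => ?_
    rw [Finset.sum_ite_eq, if_pos (Finset.mem_range.2 (Nat.mod_lt _ hm))]

lemma norm_exp_sub_exp_le (a b : ℝ) :
    ‖Complex.exp (a * Complex.I) - Complex.exp (b * Complex.I)‖ ≤ |a - b| := by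
  have h : Complex.exp (a * Complex.I) - Complex.exp (b * Complex.I) =
      Complex.exp (b * Complex.I) * (Complex.exp (Complex.I * ((a - b : ℝ) : ℂ)) - 1) := by
    rw [mul_sub, ← Complex.exp_add, mul_one]
    congr 2
    push_cast
    ring
  rw [h, norm_mul, Complex.norm_exp_ofReal_mul_I, one_mul]
  exact Real.norm_exp_I_mul_ofReal_sub_one_le

lemma exp_two_pi_div_pow (n k : ℕ) : Complex.exp (2 * Real.pi * Complex.I / n) ^ k =
    Complex.exp ((2 * Real.pi * (k / n) : ℝ) * Complex.I) := by
  rw [← Complex.exp_nat_mul]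
  congr 1
  push_cast
  ring

/-- Roots of unity of orders `n` and `n + m` with nearby indices are close to each other. -/
lemma norm_exp_pow_sub_exp_pow_le {n m p q : ℕ} (hp : p < n) (hpq : p ≤ q) (hqp : q ≤ p + m) :
    ‖Complex.exp (2 * Real.pi * Complex.I / (n + m : ℕ)) ^ q -
      Complex.exp (2 * Real.pi * Complex.I / n) ^ p‖ ≤ 2 * Real.pi * (m / (n + m : ℕ)) := by
  rw [exp_two_pi_div_pow, exp_two_pi_div_pow]
  refine (norm_exp_sub_exp_le _ _).trans ?_
  rw [← mul_sub, abs_mul, abs_of_pos Real.two_pi_pos]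
  refine mul_le_mul_of_nonneg_left ?_ Real.two_pi_pos.le
  have hn : (0 : ℝ) < n := by exact_mod_cast (by omega : 0 < n)
  have hnm : (0 : ℝ) < (n + m : ℕ) := by exact_mod_cast (by omega : 0 < n + m)
  have h1 : (p : ℝ) ≤ q := by exact_mod_cast hpq
  have h2 : (q : ℝ) ≤ p + m := by exact_mod_cast hqp
  have h3 : (p : ℝ) ≤ n := by exact_mod_cast hp.le
  have hm : (0 : ℝ) ≤ m := Nat.cast_nonneg m
  have hp0 : (0 : ℝ) ≤ p := Nat.cast_nonneg p
  -- Both `p / n` and `q / (n + m)` lie between `p / (n + m)` and `(p + m) / (n + m)`, an interval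
  -- of length `m / (n + m)`.
  have hdiv : (p : ℝ) / n ≤ (p + m) / (n + m : ℕ) := by
    rw [div_le_div_iff₀ hn hnm]
    push_cast
    nlinarith
  have hdiv' : (p : ℝ) / (n + m : ℕ) ≤ p / n := by
    refine div_le_div_of_nonneg_left hp0 hn ?_
    push_cast
    linarith
  rw [abs_le]
  constructor
  · have : (q : ℝ) / (n + m : ℕ) ≥ p / (n + m : ℕ) := by gcongr
    rw [add_div] at hdiv
    linarith
  · have : (q : ℝ) / (n + m : ℕ) ≤ (p + m) / (n + m : ℕ) := by gcongr
    rw [add_div] at this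
    linarith

end ApproximateTowers

/-! ### Rearranging the spectrum into towers of heights `m` and `m + 1` -/

section Complement

variable {D : Type*} [CStarAlgebra D] [PartialOrder D] [StarOrderedRing D]

lemma map_sqrt (α : D ≃⋆ₐ[ℂ] D) {e : D} (he : 0 ≤ e) : α (CFC.sqrt e) = CFC.sqrt (α e) := by
  refine (CFC.sqrt_unique ?_ ?_).symm
  · rw [← map_mul, CFC.sqrt_mul_sqrt_self e he]
  · exact map_nonneg α (CFC.sqrt_nonneg e)

lemma sqrt_mul_eq_zero {e x : D} (he : 0 ≤ e) (h : e * x = 0) : CFC.sqrt e * x = 0 := by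
  have hsa : star (CFC.sqrt e) = CFC.sqrt e := (IsSelfAdjoint.of_nonneg (CFC.sqrt_nonneg e)).star_eq
  rw [← CStarRing.star_mul_self_eq_zero_iff, star_mul, hsa, mul_assoc, ← mul_assoc (CFC.sqrt e),
    CFC.sqrt_mul_sqrt_self e he, h, mul_zero]

lemma columnSum_mul_columnSum_eq_zero {D : Type*} [CStarAlgebra D] {m K : ℕ} {h : ℕ → D}
    (hh : ∀ k < m * K, ∀ l < m * K, k ≠ l → h k * h l = 0) {i j : ℕ} (hi : i < m) (hj : j < m)
    (hij : i ≠ j) : columnSum m K h i * columnSum m K h j = 0 := by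
  rw [columnSum, columnSum, Finset.sum_mul_sum]
  refine Finset.sum_eq_zero fun r hr => Finset.sum_eq_zero fun r' hr' => ?_
  refine hh _ (DefectTower.add_mul_lt hi (Finset.mem_range.1 hr)) _
    (DefectTower.add_mul_lt hj (Finset.mem_range.1 hr')) fun h => hij ?_
  have := congrArg (· % m) h
  simpa [Nat.mod_eq_of_lt hi, Nat.mod_eq_of_lt hj] using this

lemma mul_star_mul_mul_star_eq_zero {D : Type*} [CStarAlgebra D] {x y : D} (h : star x * y = 0) :
    x * star x * (y * star y) = 0 := by
  rw [mul_assoc, ← mul_assoc (star x), h, zero_mul, mul_zero]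

/-- An `α`-invariant element `e` and approximate eigenvectors for all roots of unity of order
`m * K + m`, a multiple of `m + 1`, are rearranged to two orthogonal approximate towers of
heights `m` and `m + 1`. -/
lemma exists_complementary_towers {S : StarSubalgebra ℂ D} {α : D ≃⋆ₐ[ℂ] D} {m K R : ℕ}
    (hm : m ≠ 0) (hR : R ≠ 0) (hK : K + 1 = (m + 1) * R) {e : D} (he1 : e ≤ 1) (he0 : 0 ≤ e)
    (hαe : α e = e) (heS : CFC.sqrt e ∈ S) {x : ℕ → D}
    (hx : IsGramDiagonal e (Finset.range (m * K + m) : Set ℕ) x) (hex : ∀ p, e * x p = 0)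
    (hxS : ∀ p, x p ∈ S) {δ : ℝ} (hδ : 0 ≤ δ)
    (hαx : ∀ p, ‖α (x p) - Complex.exp (2 * Real.pi * Complex.I / (m * K + m : ℕ)) ^ p • x p‖ ≤
      (δ / 2) / √((m * K + m : ℕ) : ℝ))
    (hδm : 2 * Real.pi * (m / (m * K + m : ℕ)) ≤ δ / 2) :
    ∃ b c : ℕ → D, Function.Periodic b m ∧ Function.Periodic c (m + 1) ∧
      (∀ j, b j ∈ S) ∧ (∀ j, c j ∈ S) ∧ (∀ j, 0 ≤ b j) ∧ (∀ j, 0 ≤ c j) ∧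
      (∀ i < m, ∀ j < m, i ≠ j → b i * b j = 0) ∧
      (∀ i < m + 1, ∀ j < m + 1, i ≠ j → c i * c j = 0) ∧
      (∀ i j, b i * c j = 0) ∧
      (∀ j < m, ‖α (b j) - b (j + 1)‖ ≤ 2 * δ + δ ^ 2) ∧
      (∀ j < m + 1, ‖α (c j) - c (j + 1)‖ ≤ 2 * δ + δ ^ 2) ∧
      ∑ j ∈ Finset.range m, b j + ∑ j ∈ Finset.range (m + 1), c j =
        e + ∑ p ∈ Finset.range (m * K + m), x p * star (x p) := by
  classical
  set n := m * K with hn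
  have hmpos : 0 < m := Nat.pos_of_ne_zero hm
  have hK0 : K ≠ 0 := by
    rintro rfl
    have h1 : 2 * 1 ≤ (m + 1) * R :=
      Nat.mul_le_mul (by omega) (Nat.one_le_iff_ne_zero.2 hR)
    omega
  have hn0 : n ≠ 0 := mul_ne_zero hm hK0
  have hN0 : n + m ≠ 0 := by omega
  have hNR : n + m = (m + 1) * (m * R) := by
    calc n + m = m * (K + 1) := by rw [hn]; ring
      _ = _ := by rw [hK]; ring
  have hmR : 0 < m * R := Nat.mul_pos hmpos (Nat.pos_of_ne_zero hR)
  set ζ := Complex.exp (2 * Real.pi * Complex.I / (n + m : ℕ)) with hζ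
  set ξ := Complex.exp (2 * Real.pi * Complex.I / n) with hξ
  set η := Complex.exp (2 * Real.pi * Complex.I / (m + 1 : ℕ)) with hη
  have hξp : IsPrimitiveRoot ξ n := Complex.isPrimitiveRoot_exp n hn0
  have hηp : IsPrimitiveRoot η (m + 1) := Complex.isPrimitiveRoot_exp (m + 1) m.succ_ne_zero
  have hζη : ∀ q, ζ ^ (q * (m * R)) = η ^ q := by
    intro q
    rw [hζ, hη, exp_two_pi_div_pow, exp_two_pi_div_pow, hNR]
    congr 4
    have h1 : ((m * R : ℕ) : ℝ) ≠ 0 := by exact_mod_cast hmR.ne'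
    rw [Nat.cast_mul, Nat.cast_mul (m + 1), mul_div_mul_right _ _ h1]
  -- Positions of the nontrivial `(m + 1)`-th roots of unity among the `(n + m)`-th ones. Index `0`
  -- is skipped because `√e` supplies the eigenvalue `1`; `x 0` stays in the other family.
  let idx : ℕ → ℕ := fun q => (q + 1) * (m * R)
  have hidx : Function.Injective idx := fun q q' h => by
    have := Nat.eq_of_mul_eq_mul_right hmR h
    omega
  have hidx_lt : ∀ q < m, idx q < n + m := by
    intro q hq
    rw [hNR]
    exact Nat.mul_lt_mul_of_pos_right (by omega) hmR
  set Q := (Finset.range m).image idx with hQ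
  have hQsub : Q ⊆ Finset.range (n + m) := by
    intro t ht
    obtain ⟨q, hq, rfl⟩ := Finset.mem_image.1 ht
    exact Finset.mem_range.2 (hidx_lt q (Finset.mem_range.1 hq))
  have hQcard : Q.card = m := by
    rw [hQ, Finset.card_image_of_injective _ hidx, Finset.card_range]
  obtain ⟨σ, hσmem, hσinj, hσimg, hσ⟩ := exists_enumeration hQsub hQcard rfl
  have hσlt : ∀ p < n, σ p < n + m := fun p hp =>
    Finset.mem_range.1 (Finset.mem_sdiff.1 (hσmem p hp)).1
  have hσQ : ∀ p < n, ∀ q < m, σ p ≠ idx q := fun p hp q hq h =>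
    (Finset.mem_sdiff.1 (hσmem p hp)).2 (h ▸ Finset.mem_image_of_mem _ (Finset.mem_range.2 hq))
  have hsa : star (CFC.sqrt e) = CFC.sqrt e := (IsSelfAdjoint.of_nonneg (CFC.sqrt_nonneg e)).star_eq
  have hex' : ∀ p, CFC.sqrt e * x p = 0 := fun p => sqrt_mul_eq_zero he0 (hex p)
  have hxe' : ∀ p, star (x p) * CFC.sqrt e = 0 := fun p => by
    have := congrArg star (hex' p)
    rwa [star_mul, hsa, star_zero] at this
  have hxg : ∀ p < n + m, ∀ q < n + m, p ≠ q → star (x p) * x q = 0 := fun p hp q hq hpq =>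
    hx.2 p (by simpa using hp) q (by simpa using hq) hpq
  have hxg' : ∀ p < n + m, star (x p) * x p = e := fun p hp => hx.1 p (by simpa using hp)
  -- the two families of approximate eigenvectors
  let y : ℕ → D := fun q => Nat.casesOn q (CFC.sqrt e) fun q => x (idx q)
  have hygram : IsGramDiagonal e (Finset.range (m + 1) : Set ℕ) y := by
    refine ⟨fun q hq => ?_, fun q hq q' hq' hne => ?_⟩
    · have hq1 : q < m + 1 := by simpa using hq
      cases q with
      | zero => change star (CFC.sqrt e) * CFC.sqrt e = e; rw [hsa, CFC.sqrt_mul_sqrt_self e he0]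
      | succ q => exact hxg' _ (hidx_lt q (by omega))
    · have hq1 : q < m + 1 := by simpa using hq
      have hq1' : q' < m + 1 := by simpa using hq'
      cases q with
      | zero =>
        cases q' with
        | zero => exact absurd rfl hne
        | succ q' => change star (CFC.sqrt e) * x (idx q') = 0; rw [hsa, hex']
      | succ q =>
        cases q' with
        | zero => exact hxe' _
        | succ q' =>
          exact hxg _ (hidx_lt q (by omega)) _ (hidx_lt q' (by omega)) fun h =>
            hne (congrArg Nat.succ (hidx h))
  let z : ℕ → D := fun p => x (σ p)
  have hzgram : IsGramDiagonal e (Finset.range n : Set ℕ) z := by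
    have hlt : ∀ p ∈ (Finset.range n : Set ℕ), p < n := fun p hp => by simpa using hp
    refine ⟨fun p hp => hxg' _ (hσlt p (hlt p hp)), fun p hp q hq hpq => ?_⟩
    exact hxg _ (hσlt p (hlt p hp)) _ (hσlt q (hlt q hq)) fun h => hpq (hσinj hp hq h)
  have hzy : ∀ p < n, ∀ q < m + 1, star (z p) * y q = 0 := by
    intro p hp q hq
    cases q with
    | zero => exact hxe' _
    | succ q => exact hxg _ (hσlt p hp) _ (hidx_lt q (by omega)) (hσQ p hp q (by omega))
  have hyS : ∀ q < m + 1, y q ∈ S := by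
    intro q _
    cases q with
    | zero => exact heS
    | succ q => exact hxS _
  have hNpos : (0 : ℝ) < (n + m : ℕ) := by exact_mod_cast Nat.pos_of_ne_zero hN0
  have hsq : ((δ / 2) / √((n + m : ℕ) : ℝ)) ^ 2 = (δ / 2) ^ 2 / (n + m : ℕ) := by
    rw [div_pow, Real.sq_sqrt hNpos.le]
  -- There are at most `n + m` terms, each contributing at most `(δ / 2) ^ 2 / (n + m)`.
  have hsmall : ∀ {c : ℕ} {g : ℕ → D}, c ≤ n + m →
      (∀ p ∈ Finset.range c, ‖g p‖ ≤ (δ / 2) / √((n + m : ℕ) : ℝ)) →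
      ‖∑ p ∈ Finset.range c, g p * star (g p)‖ ≤ (δ / 2) ^ 2 := by
    intro c g hc hg
    refine (norm_sum_mul_star_self_le_of_norm_le _ g hg).trans ?_
    rw [hsq, Finset.card_range, ← mul_div_assoc, div_le_iff₀ hNpos, mul_comm]
    gcongr
  have hzα : ‖∑ p ∈ Finset.range n, (α (z p) - ξ ^ p • z p) * star (α (z p) - ξ ^ p • z p)‖ ≤
      δ ^ 2 := by
    -- The first summand is the eigenvector error, the second the cost of replacing `ζ ^ σ p` by `ξ
    -- ^ p`. Each has squared row norm at most `(δ / 2) ^ 2`, and `2 * (δ / 2) ^ 2 + 2 * (δ / 2) ^ 2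
    -- = δ ^ 2`.
    have hdec : ∀ p, α (z p) - ξ ^ p • z p =
        (α (z p) - ζ ^ σ p • z p) + (ζ ^ σ p - ξ ^ p) • z p := by
      intro p
      rw [sub_smul]; abel
    simp only [hdec]
    refine (norm_sum_add_mul_star_self_le _ _ _).trans ?_
    have h1 : ‖∑ p ∈ Finset.range n, (α (z p) - ζ ^ σ p • z p) *
        star (α (z p) - ζ ^ σ p • z p)‖ ≤ (δ / 2) ^ 2 :=
      hsmall (by omega) fun p _ => hαx (σ p)
    have h2 : ‖∑ p ∈ Finset.range n, ((ζ ^ σ p - ξ ^ p) • z p) *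
        star ((ζ ^ σ p - ξ ^ p) • z p)‖ ≤ (δ / 2) ^ 2 := by
      refine norm_sum_smul_mul_star_self_le _ _ _ (fun p hp => ?_) (hzgram.norm_sum_le_one he1)
      have hp' := Finset.mem_range.1 hp
      exact (norm_exp_pow_sub_exp_pow_le hp' (hσ p hp').1 (hσ p hp').2).trans hδm
    nlinarith [sq_nonneg δ]
  have hyα : ‖∑ q ∈ Finset.range (m + 1), (α (y q) - η ^ q • y q) *
      star (α (y q) - η ^ q • y q)‖ ≤ δ ^ 2 := by
    have hle : m + 1 ≤ n + m := by omega
    refine (hsmall hle fun q _ => ?_).trans (by nlinarith [sq_nonneg δ])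
    cases q with
    | zero =>
      change ‖α (CFC.sqrt e) - η ^ 0 • CFC.sqrt e‖ ≤ _
      rw [map_sqrt α he0, hαe, pow_zero, one_smul, sub_self, norm_zero]
      positivity
    | succ q =>
      rw [← hζη]
      exact hαx _
  set v := dft ξ n z with hv
  set w := dft η (m + 1) y with hw
  have hvgram : IsGramDiagonal e (Finset.range n : Set ℕ) v := hzgram.dft hξp
  have hwgram : IsGramDiagonal e (Finset.range (m + 1) : Set ℕ) w := hygram.dft hηp
  have hvper : Function.Periodic (fun k => v k * star (v k)) n := fun k => by
    simp only [hv, dft_periodic hξp.pow_eq_one z k]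
  have hvS : ∀ k, v k ∈ S := dft_mem S ξ fun p _ => hxS _
  have hwS : ∀ k, w k ∈ S := dft_mem S η hyS
  refine ⟨columnSum m K fun k => v k * star (v k), fun k => w k * star (w k),
    columnSum_periodic hvper, fun k => ?_, fun j => ?_, fun j => ?_, fun j => ?_, fun j => ?_,
    fun i hi j hj hij => ?_, fun i hi j hj hij => ?_, fun i j => ?_, fun j hj => ?_,
    fun j hj => ?_, ?_⟩
  · simp only [hw, dft_periodic hηp.pow_eq_one y k]
  · exact sum_mem fun r _ => mul_mem (hvS _) (star_mem (hvS _))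
  · exact mul_mem (hwS _) (star_mem (hwS _))
  · exact Finset.sum_nonneg fun r _ => mul_star_self_nonneg _
  · exact mul_star_self_nonneg _
  · refine columnSum_mul_columnSum_eq_zero (fun k hk l hl hkl => ?_) hi hj hij
    exact mul_star_mul_mul_star_eq_zero (hvgram.2 k (by simpa using hk) l (by simpa using hl) hkl)
  · exact mul_star_mul_mul_star_eq_zero (hwgram.2 i (by simpa using hi) j (by simpa using hj) hij)
  · rw [columnSum, Finset.sum_mul]
    exact Finset.sum_eq_zero fun r _ =>
      mul_star_mul_mul_star_eq_zero (star_dft_mul_dft_eq_zero ξ η hzy _ _)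
  · exact norm_map_columnSum_sub_le hξp α he1 hzgram hδ hzα hj
  · have := norm_map_sum_dft_sub_le hηp α he1 hygram hδ hyα (T := {j}) (by simpa using hj)
    simpa only [Finset.sum_singleton] using this
  -- By Parseval both transforms drop out, and the two index families partition the eigenvectors.
  · rw [sum_columnSum, ← hn, hv, sum_dft_mul_star hξp, hw, sum_dft_mul_star hηp,
      Finset.sum_range_succ', ← add_assoc, add_comm]
    change CFC.sqrt e * star (CFC.sqrt e) + _ = _
    rw [hsa, CFC.sqrt_mul_sqrt_self e he0]
    congr 1
    rw [← Finset.sum_sdiff hQsub, ← hσimg, Finset.sum_image hσinj, hQ,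
      Finset.sum_image hidx.injOn]

end Complement

/-! ### The three approximate towers -/

section Combination

variable {D : Type*} [CStarAlgebra D] [PartialOrder D] [StarOrderedRing D]

/-- Three approximate towers of heights `m`, `m` and `m + 1` that sum up to the unit, the last two
of which are orthogonal. -/
theorem exists_approximate_towers {S : StarSubalgebra ℂ D} {α : D ≃⋆ₐ[ℂ] D}
    (hS : ∀ x ∈ S, α x ∈ S) (hsqrt : ∀ x ∈ S, 0 ≤ x → CFC.sqrt x ∈ S)
    (H : ∀ n, n ≠ 0 → ∃ φ s, DefectTower S α n φ s) {m : ℕ} (hm : m ≠ 0) {ε : ℝ} (hε : 0 < ε) :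
    ∃ a b c : ℕ → D, Function.Periodic a m ∧ Function.Periodic b m ∧ Function.Periodic c (m + 1) ∧
      (∀ j, a j ∈ S) ∧ (∀ j, b j ∈ S) ∧ (∀ j, c j ∈ S) ∧
      (∀ j < m, 0 ≤ a j) ∧ (∀ j < m, 0 ≤ b j) ∧ (∀ j < m + 1, 0 ≤ c j) ∧
      (∀ j < m, ‖α (a j) - a (j + 1)‖ ≤ ε) ∧ (∀ j < m, ‖α (b j) - b (j + 1)‖ ≤ ε) ∧
      (∀ j < m + 1, ‖α (c j) - c (j + 1)‖ ≤ ε) ∧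
      (∀ i < m, ∀ j < m, i ≠ j → a i * a j = 0) ∧
      (∀ i < m, ∀ j < m, i ≠ j → b i * b j = 0) ∧
      (∀ i < m + 1, ∀ j < m + 1, i ≠ j → c i * c j = 0) ∧
      (∀ i j, b i * c j = 0) ∧
      ∑ j ∈ Finset.range m, a j + ∑ j ∈ Finset.range m, b j + ∑ j ∈ Finset.range (m + 1), c j =
        1 := by
  set δ := min 1 (ε / 3) with hδdef
  have hδ : 0 < δ := lt_min one_pos (by positivity)
  have hδ1 : δ ≤ 1 := min_le_left _ _
  have hδε : 2 * δ + δ ^ 2 ≤ ε := by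
    have : δ ≤ ε / 3 := min_le_right _ _
    nlinarith
  -- For `N = m * (m + 1) * R` the cost `2πm / N` of moving eigenvalues is `2π / ((m + 1) * R)`,
  -- below `δ / 2`.
  obtain ⟨R, hR⟩ := exists_nat_gt (2 * Real.pi / (δ / 2))
  have hR0 : R ≠ 0 := by
    rintro rfl
    have : 0 < 2 * Real.pi / (δ / 2) := by positivity
    simp only [Nat.cast_zero] at hR
    linarith
  obtain ⟨K, hK⟩ : ∃ K, K + 1 = (m + 1) * R :=
    ⟨(m + 1) * R - 1, Nat.sub_add_cancel (Nat.mul_pos m.succ_pos (Nat.pos_of_ne_zero hR0))⟩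
  -- `L` bounds the gap `2 / √L` of the averaged iterates by `δ / 2`.
  obtain ⟨L, hL⟩ := exists_nat_gt ((2 / (δ / 2)) ^ 2)
  have hL0 : L ≠ 0 := by
    rintro rfl
    have : 0 ≤ (2 / (δ / 2)) ^ 2 := by positivity
    simp only [Nat.cast_zero] at hL
    linarith
  have hκ : 2 / √(L : ℝ) ≤ δ / 2 := by
    have h1 : 2 / (δ / 2) ≤ √(L : ℝ) := Real.le_sqrt_of_sq_le hL.le
    rw [div_le_iff₀ (by positivity)] at h1
    rw [div_le_iff₀ (Real.sqrt_pos.2 (by exact_mod_cast Nat.pos_of_ne_zero hL0))]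
    linarith
  have hδm : 2 * Real.pi * (m / (m * K + m : ℕ)) ≤ δ / 2 := by
    have h1 : ((m * K + m : ℕ) : ℝ) = m * ((m + 1) * R) := by
      rw [← Nat.mul_succ, Nat.succ_eq_add_one, hK]
      push_cast; ring
    have hmr : (0 : ℝ) < m := by exact_mod_cast Nat.pos_of_ne_zero hm
    have hRr : (0 : ℝ) < R := by exact_mod_cast Nat.pos_of_ne_zero hR0
    rw [div_lt_iff₀ (by positivity)] at hR
    rw [h1, ← div_div, div_self hmr.ne', mul_one_div, div_le_iff₀ (by positivity)]
    nlinarith [mul_pos hmr (mul_pos hRr hδ)]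
  have hN0 : m * K + m ≠ 0 := by omega
  obtain ⟨φ, s, h⟩ := H ((m * K + m) * L) (mul_ne_zero hN0 hL0)
  obtain ⟨x, a, hx, hex, hxS, hαx, haper, haS, ha0, haa, hαa, hasum⟩ :=
    h.exists_eigenvectors hS hN0 hL0 (m := m) ⟨K + 1, by ring⟩
      (Complex.isPrimitiveRoot_exp _ hN0) hκ
  have heS : 1 - ∑ k ∈ Finset.range ((m * K + m) * L), φ k ∈ S :=
    sub_mem (one_mem S) (sum_mem fun k _ => h.mem k)
  obtain ⟨b, c, hbper, hcper, hbS, hcS, hb0, hc0, hbb, hcc, hbc, hαb, hαc, hbcsum⟩ :=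
    exists_complementary_towers hm hR0 hK h.defect_le_one h.defect_nonneg h.map_defect
      (hsqrt _ heS h.defect_nonneg) hx hex hxS hδ.le hαx hδm
  refine ⟨a, b, c, haper, hbper, hcper, haS, hbS, hcS, ha0, fun j _ => hb0 j, fun j _ => hc0 j,
    fun j hj => (hαa j hj).trans (by nlinarith), fun j hj => (hαb j hj).trans hδε,
    fun j hj => (hαc j hj).trans hδε, haa, hbb, hcc, hbc, ?_⟩
  rw [add_assoc, hbcsum, hasum]
  abel

end Combination

end RokhlinTower

namespace CentralSeq

/-! ### Stability of the central sequence algebra -/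

section Central

variable {A : Type*} [CStarAlgebra A] [Nontrivial A] {ω : Ultrafilter ℕ}

lemma mem_centralSequenceAlgebra_iff {x : Ultraproduct A ω} :
    x ∈ centralSequenceAlgebra A ω ↔
      ∀ a : A, Ultraproduct.const ω a * x = x * Ultraproduct.const ω a := by
  rw [centralSequenceAlgebra, StarSubalgebra.mem_centralizer_iff]
  constructor
  · intro h a
    exact (h _ ⟨a, rfl⟩).1
  · rintro h _ ⟨a, rfl⟩
    exact ⟨h a, h (star a)⟩

lemma map_mem_centralSequenceAlgebra (α : A ≃⋆ₐ[ℂ] A) {x : Ultraproduct A ω}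
    (hx : x ∈ centralSequenceAlgebra A ω) :
    Ultraproduct.map ω α x ∈ centralSequenceAlgebra A ω := by
  rw [mem_centralSequenceAlgebra_iff] at hx ⊢
  intro a
  have h : Ultraproduct.const ω a = Ultraproduct.map ω α (Ultraproduct.const ω (α.symm a)) := by
    change Ultraproduct.mk ω _ = Ultraproduct.mk ω _
    congr 1
    ext n
    exact (α.apply_symm_apply a).symm
  rw [h, ← map_mul, hx, map_mul]

lemma sqrt_mem_centralSequenceAlgebra {x : Ultraproduct A ω}
    (hx : x ∈ centralSequenceAlgebra A ω) (h0 : 0 ≤ x) :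
    CFC.sqrt x ∈ centralSequenceAlgebra A ω := by
  rw [mem_centralSequenceAlgebra_iff] at hx ⊢
  intro a
  rw [CFC.sqrt_eq_real_sqrt x h0]
  exact ((Commute.cfcₙ_real (hx a).symm _).symm).eq

end Central

/-! ### Passing between `A` and `A_ω` -/

section Coordinates

variable {A : Type*} [CStarAlgebra A] [Nontrivial A] {ω : Ultrafilter ℕ}

/-- A bounded sequence as an element of `ℓ^∞(ℕ, A)`. -/
def boundedSeq (f : ℕ → A) {C : ℝ} (hf : ∀ n, ‖f n‖ ≤ C) : LInfty A :=
  ⟨f, memℓp_infty ⟨C, by rintro _ ⟨n, rfl⟩; exact hf n⟩⟩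

/-- Contractions in `A_ω` lift to sequences of contractions. -/
lemma exists_contractive_lift {x : Ultraproduct A ω} (hx : ‖x‖ ≤ 1) :
    ∃ a : LInfty A, Ultraproduct.mk ω a = x ∧ ∀ n, ‖a n‖ ≤ 1 := by
  obtain ⟨b, rfl⟩ := Ultraproduct.mk_surjective ω x
  have hpos : ∀ n, 0 < max 1 ‖b n‖ := fun n => lt_max_of_lt_left one_pos
  have hle : ∀ n, ‖(max 1 ‖b n‖)⁻¹ • b n‖ ≤ 1 := by
    intro n
    rw [norm_smul, norm_inv, Real.norm_of_nonneg (hpos n).le, inv_mul_le_one₀ (hpos n)]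
    exact le_max_right _ _
  -- Rescaling changes the `n`-th term by at most `max 1 ‖b n‖ - 1`, which tends to `0` as `‖x‖ ≤
  -- 1`.
  refine ⟨boundedSeq _ hle, ?_, hle⟩
  rw [Ultraproduct.mk_eq_mk]
  have h1 : Tendsto (fun n => max 1 ‖b n‖ - 1) ω (𝓝 0) := by
    have := (tendsto_const_nhds (x := (1 : ℝ))).max (Ultraproduct.tendsto_norm_mk (ω := ω) b)
    rw [max_eq_left hx] at this
    simpa using this.sub_const 1
  refine squeeze_zero (fun n => norm_nonneg _) (fun n => ?_) h1
  have h2 : (max 1 ‖b n‖)⁻¹ • b n - b n = ((max 1 ‖b n‖)⁻¹ - 1) • b n := by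
    rw [sub_smul, one_smul]
  change ‖(max 1 ‖b n‖)⁻¹ • b n - b n‖ ≤ _
  have h3 : (max 1 ‖b n‖)⁻¹ ≤ 1 := inv_le_one_of_one_le₀ (le_max_left _ _)
  rw [h2, norm_smul, Real.norm_of_nonpos (by linarith)]
  calc _ ≤ -((max 1 ‖b n‖)⁻¹ - 1) * max 1 ‖b n‖ := by
        gcongr
        · linarith
        · exact le_max_right _ _
    _ = max 1 ‖b n‖ - 1 := by
        have := (hpos n).ne'
        field_simp
        ring

lemma norm_mk_le_one {a : LInfty A} (ha1 : ∀ n, ‖a n‖ ≤ 1) : ‖Ultraproduct.mk ω a‖ ≤ 1 :=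
  (Ultraproduct.norm_mk_le a).trans (lp.norm_le_of_forall_le zero_le_one ha1)

lemma sum_apply {ι : Type*} [Fintype ι] (a : ι → LInfty A) (n : ℕ) : (∑ i, a i) n = ∑ i, a i n := by
  rw [lp.coeFn_sum, Finset.sum_apply]

lemma continuous_ultraproduct_const : Continuous (Ultraproduct.const ω : A → Ultraproduct A ω) := by
  refine (LipschitzWith.of_dist_le_mul (K := 1) fun a b => ?_).continuous
  rw [dist_eq_norm, dist_eq_norm, NNReal.coe_one, one_mul, Ultraproduct.const, Ultraproduct.const,
    ← map_sub]
  exact (Ultraproduct.norm_mk_le _).trans (lp.norm_le_of_forall_le (norm_nonneg _) fun n => le_rfl)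

variable [PartialOrder A] [StarOrderedRing A]

/-- Positive contractions in `A_ω` lift to sequences of positive contractions. -/
lemma exists_pos_contractive_lift {x : Ultraproduct A ω} (h0 : 0 ≤ x) (h1 : ‖x‖ ≤ 1) :
    ∃ a : LInfty A, Ultraproduct.mk ω a = x ∧ ∀ n, 0 ≤ a n ∧ ‖a n‖ ≤ 1 := by
  obtain ⟨y, rfl⟩ := CStarAlgebra.nonneg_iff_eq_star_mul_self.1 h0
  have hy : ‖y‖ ≤ 1 := by
    rw [CStarRing.norm_star_mul_self] at h1
    nlinarith [norm_nonneg y]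
  obtain ⟨b, rfl, hb⟩ := exists_contractive_lift hy
  refine ⟨star b * b, by rw [map_mul, Ultraproduct.star_mk], fun n => ?_⟩
  have hn : (star b * b) n = star (b n) * b n := rfl
  rw [hn, CStarRing.norm_star_mul_self]
  exact ⟨star_mul_self_nonneg _, mul_le_one₀ (hb n) (norm_nonneg _) (hb n)⟩

lemma mk_nonneg {a : LInfty A} (ha : ∀ n, 0 ≤ a n) (ha1 : ∀ n, ‖a n‖ ≤ 1) :
    0 ≤ Ultraproduct.mk ω a := by
  have hsa : ∀ n, star (CFC.sqrt (a n)) = CFC.sqrt (a n) := fun n =>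
    (IsSelfAdjoint.of_nonneg (CFC.sqrt_nonneg (a n))).star_eq
  have hs : ∀ n, star (CFC.sqrt (a n)) * CFC.sqrt (a n) = a n := fun n => by
    rw [hsa, CFC.sqrt_mul_sqrt_self _ (ha n)]
  have hb : ∀ n, ‖CFC.sqrt (a n)‖ ≤ 1 := by
    intro n
    have h1 := ha1 n
    rw [← hs n, CStarRing.norm_star_mul_self] at h1
    nlinarith [norm_nonneg (CFC.sqrt (a n))]
  have : a = star (boundedSeq _ hb) * boundedSeq _ hb := by
    ext n
    exact (hs n).symm
  rw [this, map_mul, ← Ultraproduct.star_mk]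
  exact star_mul_self_nonneg _

variable {ι : Type*} [Fintype ι]

/-- A tuple of positive contractions of `A` that is shifted by `α` along `σ`, orthogonal along `r`,
sums up to `1` and commutes with `F`, all up to `ε`. -/
structure IsApproxPartition (α : A ≃⋆ₐ[ℂ] A) (σ : ι → ι) (r : ι → ι → Prop) (F : Finset A) (ε : ℝ)
    (y : ι → A) : Prop where
  nonneg : ∀ i, 0 ≤ y i
  norm_le_one : ∀ i, ‖y i‖ ≤ 1
  map : ∀ i, ‖α (y i) - y (σ i)‖ < ε
  orthogonal : ∀ i j, r i j → ‖y i * y j‖ < ε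
  sum : ‖∑ i, y i - 1‖ < ε
  comm : ∀ i, ∀ d ∈ F, ‖y i * d - d * y i‖ < ε

/-- Only finitely many strict inequalities are required, each holding for `ω`-almost every
coordinate of lifts to positive contractions; one coordinate satisfies them all. -/
lemma exists_isApproxPartition (α : A ≃⋆ₐ[ℂ] A) (σ : ι → ι) (r : ι → ι → Prop) (F : Finset A)
    {ε : ℝ} (hε : 0 < ε) {z : ι → Ultraproduct A ω} (hz : ∀ i, IsCentralPosContraction ω (z i))
    (hmap : ∀ i, ‖Ultraproduct.map ω α (z i) - z (σ i)‖ < ε)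
    (horth : ∀ i j, r i j → z i * z j = 0) (hsum : ∑ i, z i = 1) :
    ∃ y : ι → A, IsApproxPartition α σ r F ε y := by
  choose a ha ha' using fun i => exists_pos_contractive_lift (hz i).2.1 (hz i).2.2
  have hev : ∀ b : LInfty A, ‖Ultraproduct.mk ω b‖ < ε → ∀ᶠ n in (ω : Filter ℕ), ‖b n‖ < ε :=
    fun b hb => (Ultraproduct.tendsto_norm_mk b).eventually_lt_const hb
  have h1 : ∀ᶠ n in (ω : Filter ℕ), ∀ i, ‖α (a i n) - a (σ i) n‖ < ε := by
    refine eventually_all.2 fun i => ?_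
    refine hev (Ultraproduct.mapSeq α (a i) - a (σ i)) ?_
    rw [map_sub, ← Ultraproduct.mapFun_mk, ha, ha]
    exact hmap i
  have h2 : ∀ᶠ n in (ω : Filter ℕ), ∀ i j, r i j → ‖a i n * a j n‖ < ε := by
    refine eventually_all.2 fun i => eventually_all.2 fun j => eventually_imp_distrib_left.2
      fun hij => ?_
    refine hev (a i * a j) ?_
    rwa [map_mul, ha, ha, horth i j hij, norm_zero]
  have h3 : ∀ᶠ n in (ω : Filter ℕ), ‖∑ i, a i n - 1‖ < ε := by
    have := hev (∑ i, a i - 1) (by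
      rw [map_sub, map_sum, map_one]
      simpa only [ha, hsum, sub_self, norm_zero] using hε)
    filter_upwards [this] with n hn
    have h : (∑ i, a i - 1) n = (∑ i, a i) n - 1 := rfl
    rwa [h, sum_apply] at hn
  have h4 : ∀ᶠ n in (ω : Filter ℕ), ∀ i, ∀ d ∈ F, ‖a i n * d - d * a i n‖ < ε := by
    refine eventually_all.2 fun i => (eventually_all_finset F).2 fun d _ => ?_
    refine hev (a i * Ultraproduct.constSeq d - Ultraproduct.constSeq d * a i) ?_
    have := mem_centralSequenceAlgebra_iff.1 (hz i).1 d
    rw [map_sub, map_mul, map_mul, ha]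
    change ‖z i * Ultraproduct.const ω d - Ultraproduct.const ω d * z i‖ < ε
    rwa [this, sub_self, norm_zero]
  obtain ⟨n, h1, h2, h3, h4⟩ := (h1.and (h2.and (h3.and h4))).exists
  exact ⟨fun i => a i n, fun i => (ha' i n).1, fun i => (ha' i n).2, h1, h2, h3, h4⟩

/-- Approximate partitions in a separable algebra assemble to an exact one in the central sequence
algebra. -/
lemma exists_exact_partition [TopologicalSpace.SeparableSpace A]
    (hω : (ω : Filter ℕ) ≤ Filter.cofinite) (α : A ≃⋆ₐ[ℂ] A) (σ : ι → ι) (r : ι → ι → Prop)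
    (H : ∀ (F : Finset A) (ε : ℝ), 0 < ε → ∃ y : ι → A, IsApproxPartition α σ r F ε y) :
    ∃ z : ι → Ultraproduct A ω, (∀ i, IsCentralPosContraction ω (z i)) ∧
      (∀ i, Ultraproduct.map ω α (z i) = z (σ i)) ∧ (∀ i j, r i j → z i * z j = 0) ∧
      ∑ i, z i = 1 := by
  classical
  have hpos : ∀ k : ℕ, (0 : ℝ) < 1 / (k + 1) := fun k => Nat.one_div_pos_of_nat
  -- The `k`-th coordinate has tolerance `1 / (k + 1)` and nearly commutes with the first `k`
  -- members of a dense sequence. Since `ω` is free, all errors vanish in `A_ω`.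
  choose y hy using fun k : ℕ =>
    H ((Finset.range k).image (TopologicalSpace.denseSeq A)) (1 / (k + 1)) (hpos k)
  have hω' : (ω : Filter ℕ) ≤ atTop := Nat.cofinite_eq_atTop ▸ hω
  have hlim : Tendsto (fun k : ℕ => (1 : ℝ) / (k + 1)) ω (𝓝 0) :=
    tendsto_one_div_add_atTop_nhds_zero_nat.mono_left hω'
  let a : ι → LInfty A := fun i => boundedSeq (fun n => y n i) fun n => (hy n).norm_le_one i
  have hzero : ∀ b : LInfty A, (∀ᶠ n in (ω : Filter ℕ), ‖b n‖ ≤ 1 / (n + 1)) →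
      Ultraproduct.mk ω b = 0 := by
    intro b hb
    rw [← norm_le_zero_iff]
    exact le_of_tendsto_of_tendsto (Ultraproduct.tendsto_norm_mk b) hlim hb
  refine ⟨fun i => Ultraproduct.mk ω (a i), fun i => ⟨?_, ?_, ?_⟩, fun i => ?_, fun i j hij => ?_,
    ?_⟩
  · rw [mem_centralSequenceAlgebra_iff]
    -- Commutation with the dense sequence extends to all of `A` by continuity.
    refine congrFun ((TopologicalSpace.denseRange_denseSeq A).equalizer
      (continuous_ultraproduct_const.mul continuous_const) (continuous_const.mul continuous_ultraproduct_const)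
      (funext fun l => ?_))
    refine (sub_eq_zero.1 ?_).symm
    change Ultraproduct.mk ω (a i) * Ultraproduct.mk ω _ - Ultraproduct.mk ω _ *
      Ultraproduct.mk ω (a i) = 0
    rw [← map_mul, ← map_mul, ← map_sub]
    refine hzero _ ?_
    filter_upwards [hω' (eventually_gt_atTop l)] with n hn
    exact ((hy n).comm i _ (Finset.mem_image_of_mem _ (Finset.mem_range.2 hn))).le
  · exact mk_nonneg (fun n => (hy n).nonneg i) fun n => (hy n).norm_le_one i
  · exact norm_mk_le_one fun n => (hy n).norm_le_one i
  · refine sub_eq_zero.1 ?_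
    change Ultraproduct.mk ω (Ultraproduct.mapSeq α (a i)) - Ultraproduct.mk ω (a (σ i)) = 0
    rw [← map_sub]
    exact hzero _ (Eventually.of_forall fun n => ((hy n).map i).le)
  · rw [← map_mul]
    exact hzero _ (Eventually.of_forall fun n => ((hy n).orthogonal i j hij).le)
  · rw [← sub_eq_zero, ← map_sum, ← map_one (Ultraproduct.mk ω), ← map_sub]
    refine hzero _ (Eventually.of_forall fun n => ?_)
    have h : (∑ i, a i - 1) n = (∑ i, a i) n - 1 := rfl
    rw [h, sum_apply]
    exact (hy n).sum.le

end Coordinates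

/-! ### Applying property (SI), and the Rokhlin dimension -/

section RokhlinTowers

variable {A : Type*} [CStarAlgebra A] [PartialOrder A] [StarOrderedRing A] [Nontrivial A]
  {ω : Ultrafilter ℕ}

/-- Property (SI) supplies an element subordinate to an approximate Rokhlin tower whose modulus is
the defect of the tower. -/
lemma exists_defectTower (hSI : PropertySI A ω) {α : A ≃⋆ₐ[ℂ] A} (hα : ApproxRokhlin ω α) {n : ℕ}
    (hn : n ≠ 0) : ∃ φ s, RokhlinTower.DefectTower (centralSequenceAlgebra A ω)
      (Ultraproduct.map ω α) n φ s := by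
  have : NeZero n := ⟨hn⟩
  obtain ⟨f, hf, hmap, horth, ⟨hJ, hF⟩, hsup⟩ := hα n
  have hle : ∀ k, f k ≤ 1 := fun k =>
    (CStarAlgebra.norm_le_one_iff_of_nonneg _ (hf k).2.1).1 (hf k).2.2
  have hsum : ∑ k, f k ≤ 1 :=
    RokhlinTower.sum_le_one_of_orthogonal _ f (fun k => (hf k).2.1) hle horth
  have he0 : 0 ≤ 1 - ∑ k, f k := sub_nonneg.2 hsum
  have he1 : ‖1 - ∑ k, f k‖ ≤ 1 := (CStarAlgebra.norm_le_one_iff_of_nonneg _ he0).2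
    (sub_le_self _ (Finset.sum_nonneg fun k _ => (hf k).2.1))
  obtain ⟨s, hs, hfs, hss⟩ := hSI _ (f 0) ⟨hF, he0, he1⟩ (hf 0) hJ hsup
  have hofNat : ∀ k : Fin n, Fin.ofNat n k = k := fun k =>
    Fin.ext (by simp [Fin.ofNat, Nat.mod_eq_of_lt k.2])
  refine ⟨fun k => f (Fin.ofNat n k), s, fun k => ?_, fun k => (hf _).1, fun k => (hf _).2.1,
    fun k => ?_, fun k l hkl => horth _ _ fun h => hkl ?_, hs, ?_, ?_⟩
  · simp [Fin.ofNat]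
  · rw [hmap]
    congr 1
    ext
    simp [Fin.ofNat, Fin.val_add]
  · simpa [Fin.ofNat, Fin.ext_iff, Nat.ModEq] using h
  · simpa [Fin.ofNat] using hfs
  · rw [hss, Finset.sum_range]
    simp only [hofNat]

/-- Pairs of indices of the three towers at which the towers are orthogonal. -/
def TowerOrthogonal (m : ℕ) : Fin m ⊕ Fin m ⊕ Fin (m + 1) → Fin m ⊕ Fin m ⊕ Fin (m + 1) → Prop
  | .inl i, .inl j => i ≠ j
  | .inr (.inl i), .inr (.inl j) => i ≠ j
  | .inr (.inr i), .inr (.inr j) => i ≠ j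
  | .inr (.inl _), .inr (.inr _) => True
  | _, _ => False

/-- The cyclic shift on the indices of the three towers. -/
def towerShift (m : ℕ) [NeZero m] :
    Fin m ⊕ Fin m ⊕ Fin (m + 1) → Fin m ⊕ Fin m ⊕ Fin (m + 1) :=
  Sum.map (· + 1) (Sum.map (· + 1) (· + 1))

lemma periodic_val_add_one {B : Type*} {m : ℕ} [NeZero m] {g : ℕ → B} (hg : Function.Periodic g m)
    (k : Fin m) : g (k + 1 : Fin m).val = g (k.val + 1) := by
  rw [Fin.val_add, hg.map_mod_nat, Fin.val_one', ← hg.map_mod_nat, Nat.add_mod_mod,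
    hg.map_mod_nat]

lemma exists_isApproxPartition_tower (hSI : PropertySI A ω) {α : A ≃⋆ₐ[ℂ] A}
    (hα : ApproxRokhlin ω α) (m : ℕ) [NeZero m] (F : Finset A) {ε : ℝ} (hε : 0 < ε) :
    ∃ y, IsApproxPartition α (towerShift m) (TowerOrthogonal m) F ε y := by
  obtain ⟨a, b, c, hap, hbp, hcp, haS, hbS, hcS, ha0, hb0, hc0, hαa, hαb, hαc, haa, hbb, hcc, hbc,
    hsum⟩ := RokhlinTower.exists_approximate_towers (S := centralSequenceAlgebra A ω)
      (α := Ultraproduct.map ω α) (fun x hx => map_mem_centralSequenceAlgebra α hx)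
      (fun x hx h0 => sqrt_mem_centralSequenceAlgebra hx h0)
      (fun n hn => exists_defectTower hSI hα hn) (NeZero.ne m) (half_pos hε)
  let z : Fin m ⊕ Fin m ⊕ Fin (m + 1) → Ultraproduct A ω :=
    Sum.elim (fun k => a k) (Sum.elim (fun k => b k) fun k => c k)
  have hz0 : ∀ i, 0 ≤ z i := by
    rintro (i | i | i)
    · exact ha0 i i.2
    · exact hb0 i i.2
    · exact hc0 i i.2
  have hzsum : ∑ i, z i = 1 := by
    rw [Fintype.sum_sum_type, Fintype.sum_sum_type, ← hsum, Finset.sum_range, Finset.sum_range,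
      Finset.sum_range, add_assoc]
    rfl
  refine exists_isApproxPartition α _ _ F hε (z := z) (fun i => ⟨?_, hz0 i, ?_⟩) ?_ ?_ hzsum
  · rcases i with i | i | i
    · exact haS i
    · exact hbS i
    · exact hcS i
  · rw [CStarAlgebra.norm_le_one_iff_of_nonneg _ (hz0 i), ← hzsum]
    exact Finset.single_le_sum (fun j _ => hz0 j) (Finset.mem_univ i)
  · rintro (i | i | i) <;> refine lt_of_le_of_lt ?_ (half_lt_self hε)
    · change ‖_ - a (i + 1 : Fin m).val‖ ≤ _
      rw [periodic_val_add_one hap]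
      exact hαa i i.2
    · change ‖_ - b (i + 1 : Fin m).val‖ ≤ _
      rw [periodic_val_add_one hbp]
      exact hαb i i.2
    · change ‖_ - c (i + 1 : Fin (m + 1)).val‖ ≤ _
      rw [periodic_val_add_one hcp]
      exact hαc i i.2
  · rintro (i | i | i) (j | j | j) hij <;> try exact hij.elim
    · exact haa i i.2 j j.2 (Fin.val_ne_of_ne hij)
    · exact hbb i i.2 j j.2 (Fin.val_ne_of_ne hij)
    · exact hbc i j
    · exact hcc i i.2 j j.2 (Fin.val_ne_of_ne hij)

/-- Approximate partitions into towers of heights `m`, `m` and `m + 1`, the last two of which are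
orthogonal, show that the Rokhlin dimension is at most one. -/
lemma hasRokhlinTowers_one {A : Type*} [CStarAlgebra A] [PartialOrder A] [StarOrderedRing A]
    (α : A ≃⋆ₐ[ℂ] A) (H : ∀ (m : ℕ) [NeZero m] (F : Finset A) (ε : ℝ), 0 < ε →
      ∃ y, IsApproxPartition α (towerShift m) (TowerOrthogonal m) F ε y) :
    HasRokhlinTowers α 1 := by
  intro F p ε hp hε
  have : NeZero p := ⟨hp.ne'⟩
  -- Half of `ε` because the closing condition for the colour carrying both `b` and `c` adds two
  -- errors.
  obtain ⟨y, hy⟩ := H p F (ε / 2) (half_pos hε)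
  have hy2 : ∀ {t : ℝ}, t < ε / 2 → t < ε := fun h => h.trans (half_lt_self hε)
  let a : ℕ → A := fun k => y (.inl (Fin.ofNat p k))
  let b : ℕ → A := fun k => y (.inr (.inl (Fin.ofNat p k)))
  let c : ℕ → A := fun k => y (.inr (.inr (Fin.ofNat (p + 1) k)))
  -- The tower `a` need not be orthogonal to `b` and `c`, so it gets its own colour, with a zero
  -- tower of height `p + 1`; `b` and `c` share the other colour.
  let f : Fin 2 → Fin 2 → ℕ → A := ![![a, fun _ => 0], ![b, c]]
  have hcoe : ∀ {q i j : ℕ} [NeZero q], i < q → j < q → i ≠ j → Fin.ofNat q i ≠ Fin.ofNat q j := by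
    intro q i j _ hi hj hij h
    have := congrArg Fin.val h
    rw [Fin.val_ofNat, Fin.val_ofNat, Nat.mod_eq_of_lt hi, Nat.mod_eq_of_lt hj] at this
    exact hij this
  have hofNat : ∀ {q : ℕ} [NeZero q] (k : Fin q), Fin.ofNat q k = k := fun {q} _ k =>
    Fin.ext (by simp)
  have hsucc : ∀ {q : ℕ} [NeZero q] (k : ℕ), Fin.ofNat q k + 1 = Fin.ofNat q (k + 1) :=
    fun {q} _ k => Fin.ext (by simp [Fin.val_add])
  have hlast : ∀ {q : ℕ} [NeZero q], Fin.ofNat q (q - 1 + 1) = Fin.ofNat q 0 := fun {q} _ =>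
    Fin.ext (by simp [Nat.sub_add_cancel (Nat.one_le_iff_ne_zero.2 (NeZero.ne q))])
  have hαa : ∀ k, ‖α (a k) - a (k + 1)‖ < ε / 2 := fun k => by
    simp only [a, ← hsucc]
    exact hy.map (.inl (Fin.ofNat p k))
  have hαb : ∀ k, ‖α (b k) - b (k + 1)‖ < ε / 2 := fun k => by
    simp only [b, ← hsucc]
    exact hy.map (.inr (.inl (Fin.ofNat p k)))
  have hαc : ∀ k, ‖α (c k) - c (k + 1)‖ < ε / 2 := fun k => by
    simp only [c, ← hsucc]
    exact hy.map (.inr (.inr (Fin.ofNat (p + 1) k)))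
  have ha : a (p - 1 + 1) = a 0 := by simp only [a, hlast]
  have hb : b (p - 1 + 1) = b 0 := by simp only [b, hlast]
  have hc : c (p + 1) = c 0 := by
    have := hlast (q := p + 1)
    simp only [Nat.add_sub_cancel] at this
    simp only [c, this]
  refine ⟨f, ?_, ?_, ?_, ?_, ?_, ?_⟩
  · intro l r j _
    fin_cases l <;> fin_cases r
    · exact ⟨hy.nonneg _, hy.norm_le_one _⟩
    · exact ⟨le_rfl, norm_zero.trans_le zero_le_one⟩
    · exact ⟨hy.nonneg _, hy.norm_le_one _⟩
    · exact ⟨hy.nonneg _, hy.norm_le_one _⟩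
  · intro l q r i j hi hj hne
    have hswap : ‖c i * b j‖ < ε := by
      have h1 := hy.orthogonal (.inr (.inl (Fin.ofNat p j))) (.inr (.inr (Fin.ofNat (p + 1) i)))
        trivial
      have h2 : star (b j * c i) = c i * b j := by
        rw [star_mul, (IsSelfAdjoint.of_nonneg (hy.nonneg _)).star_eq,
          (IsSelfAdjoint.of_nonneg (hy.nonneg _)).star_eq]
      rw [← h2, norm_star]
      exact hy2 h1
    fin_cases l <;> fin_cases q <;> fin_cases r
    · refine hy2 (hy.orthogonal (.inl _) (.inl _) (hcoe hi hj ?_))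
      rintro rfl; exact hne rfl
    · change ‖a i * 0‖ < ε
      rwa [mul_zero, norm_zero]
    · change ‖0 * a j‖ < ε
      rwa [zero_mul, norm_zero]
    · change ‖(0 : A) * 0‖ < ε
      rwa [zero_mul, norm_zero]
    · refine hy2 (hy.orthogonal (.inr (.inl _)) (.inr (.inl _)) (hcoe hi hj ?_))
      rintro rfl; exact hne rfl
    · exact hy2 (hy.orthogonal (.inr (.inl _)) (.inr (.inr _)) trivial)
    · exact hswap
    · refine hy2 (hy.orthogonal (.inr (.inr _)) (.inr (.inr _)) (hcoe hi hj ?_))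
      rintro rfl; exact hne rfl
  · have hsum : ∑ l : Fin 2, ∑ r : Fin 2, ∑ j ∈ Finset.range (p + r), f l r j = ∑ i, y i := by
      rw [Fintype.sum_sum_type, Fintype.sum_sum_type, Fin.sum_univ_two, Fin.sum_univ_two,
        Fin.sum_univ_two]
      change ∑ j ∈ Finset.range p, a j + ∑ j ∈ Finset.range (p + 1), 0 +
        (∑ j ∈ Finset.range p, b j + ∑ j ∈ Finset.range (p + 1), c j) = _
      rw [Finset.sum_const_zero, add_zero, Finset.sum_range, Finset.sum_range, Finset.sum_range]
      simp only [a, b, c, hofNat]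
    change ‖∑ l : Fin 2, ∑ r : Fin 2, ∑ j ∈ Finset.range (p + r), f l r j - 1‖ < ε
    rw [hsum]
    exact hy2 hy.sum
  · intro l r j _
    fin_cases l <;> fin_cases r
    · exact hy2 (hαa j)
    · change ‖α 0 - 0‖ < ε
      rwa [map_zero, sub_zero, norm_zero]
    · exact hy2 (hαb j)
    · exact hy2 (hαc j)
  · intro l
    fin_cases l
    · change ‖α (a (p - 1) + 0) - (a 0 + 0)‖ < ε
      rw [add_zero, add_zero, ← ha]
      exact hy2 (hαa _)
    · change ‖α (b (p - 1) + c p) - (b 0 + c 0)‖ < ε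
      rw [← hb, ← hc, map_add, add_sub_add_comm]
      refine (norm_add_le _ _).trans_lt ?_
      linarith [hαb (p - 1), hαc p]
  · intro l r j _ d hd
    fin_cases l <;> fin_cases r
    · exact hy2 (hy.comm _ d hd)
    · change ‖0 * d - d * 0‖ < ε
      rwa [zero_mul, mul_zero, sub_zero, norm_zero]
    · exact hy2 (hy.comm _ d hd)
    · exact hy2 (hy.comm _ d hd)

end RokhlinTowers

end CentralSeq

theorem theorem6 (A : Type*) [CStarAlgebra A] [PartialOrder A] [StarOrderedRing A] [Nontrivial A]
    [TopologicalSpace.SeparableSpace A] (hsimple : IsSimpleCStar A)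
    (hT : (traceSpace A).Nonempty)
    (ω : Ultrafilter ℕ) (hω : (ω : Filter ℕ) ≤ Filter.cofinite)
    (hSI : PropertySI A ω)
    (α : A ≃⋆ₐ[ℂ] A) (hα : ApproxRokhlin ω α) :
    (∀ (m : ℕ) [NeZero m],
      ∃ (a b : Fin m → Ultraproduct A ω) (c : Fin (m + 1) → Ultraproduct A ω),
        (∀ k, IsCentralPosContraction ω (a k)) ∧
        (∀ k, IsCentralPosContraction ω (b k)) ∧
        (∀ k, IsCentralPosContraction ω (c k)) ∧
        (∀ k, Ultraproduct.map ω α (a k) = a (k + 1)) ∧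
        (∀ k, Ultraproduct.map ω α (b k) = b (k + 1)) ∧
        (∀ k, Ultraproduct.map ω α (c k) = c (k + 1)) ∧
        (∀ i j, i ≠ j → a i * a j = 0) ∧
        (∀ i j, i ≠ j → b i * b j = 0) ∧
        (∀ i j, i ≠ j → c i * c j = 0) ∧
        (∀ i j, b i * c j = 0) ∧
        (∑ k, a k) + (∑ k, b k) + (∑ k, c k) = 1) ∧
    rokhlinDim α ≤ 1 := by
  refine ⟨fun m _ => ?_, ?_⟩
  · obtain ⟨z, hz, hmap, horth, hsum⟩ := exists_exact_partition hω α (towerShift m)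
      (TowerOrthogonal m) fun F ε hε => exists_isApproxPartition_tower hSI hα m F hε
    refine ⟨fun k => z (.inl k), fun k => z (.inr (.inl k)), fun k => z (.inr (.inr k)),
      fun k => hz _, fun k => hz _, fun k => hz _, fun k => hmap _, fun k => hmap _,
      fun k => hmap _, fun i j hij => horth (.inl i) (.inl j) hij,
      fun i j hij => horth (.inr (.inl i)) (.inr (.inl j)) hij,
      fun i j hij => horth (.inr (.inr i)) (.inr (.inr j)) hij,
      fun i j => horth (.inr (.inl i)) (.inr (.inr j)) trivial, ?_⟩
    rw [← hsum, Fintype.sum_sum_type, Fintype.sum_sum_type, add_assoc]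
  · exact iInf₂_le_of_le 1 (hasRokhlinTowers_one α fun m _ F ε hε =>
      exists_isApproxPartition_tower hSI hα m F hε) le_rfl
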